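/- **Setting.** Let $\mathcal K\subseteq\mathbb R^{S}\times\mathbb R_+$ be a closed convex cone with nonempty interior whose slice $\Xi=\{\xi\in\mathcal K:\ \mathbf e_{S+1}^\top\xi=1\}$ is compact. Let $\xi_1',\dots,\xi_K'\in\mathbb R^{S+1}$ be constructor points such that for each $k$ some point of $\Xi$ is strictly closer to $\xi_k'$ than to all other constructor points. Let $\Xi_1,\dots,\Xi_K$ be the corresponding Voronoi cells of $\Xi$: measurable sets with union $\Xi$ and $\|\xi-\xi_k'\|_2\le\|\xi-\xi_i'\|_2$ for all $\xi\in\Xi_k$ and $i\ne k$ (equidistant points may belong to all of their cells, so that $\Xi_k$ is the closed Voronoi cell, or be allotted to any one of them). Put $$\mathcal K_k=\{\xi\in\mathcal K:\ 2(\xi_i'-\xi_k')^\top\xi\le(\xi_i'^\top\xi_i'-\xi_k'^\top\xi_k')\,\mathbf e_{S+1}^\top\xi\ \ \forall i\neq k\},$$ $$\mathcal C(\mathcal K_k)=\{X\in\mathbb S^{S+1}:\ v^\top Xv\ge0\ \ \forall v\in\mathcal K_k\}.$$ Let $\hat\xi_1,\dots,\hat\xi_N\in\Xi$ be samples, each in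 exactly one cell, with $\mathcal I_k=\{i:\hat\xi_i\in\Xi_k\}\ne\emptyset$ for every $k$. Put $\hat p_k=|\mathcal I_k|/N$, $\hat{\mathbb P}_k=|\mathcal I_k|^{-1}\sum_{i\in\mathcal I_k}\delta_{\hat\xi_i}$ and $\hat\Omega_k=|\mathcal I_k|^{-1}\sum_{i\in\mathcal I_k}\hat\xi_i\hat\xi_i^\top$. For $\gamma\ge0$ and $\epsilon_k\ge0$ let $$\Delta=\Big\{p\in\mathbb R_+^K:\ \mathbf e^\top p=1,\ \sum_k (p_k-\hat p_k)^2/p_k\le\gamma\Big\},$$ $$\mathcal P_k=\{\mathbb P_k\in\mathcal P(\Xi_k):\ \|\mathbb E_{\mathbb P_k}[\xi\xi^\top]-\mathbb E_{\hat{\mathbb P}_k}[\xi\xi^\top]\|_F\le\epsilon_k\},$$ where $\mathcal P(\cdot)$ denotes the set of Borel probability measures supported on a set and $a/0=\infty$ for $a>0$. Let $\mathcal P$ be the set of $\mathbb P\in\mathcal P(\Xi)$ of the form $\sum_kp_k\mathbb P_k$ with $p\in\Delta$ and $\mathbb P_k\in\mathcal P_k$ for all $k$, and with $\mathbb P(\Xi_i\cap\Xi_k)=0$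 for $i\ne k$ (automatic for disjoint cells). Let $\mathcal X\subseteq\mathbb R^{N_1}$, $c\in\mathbb R^{N_1}$, $\delta\in(0,1]$, $D,W_\ell\in\mathbb R^{N_2\times(S+1)}$, and let $T_\ell:\mathbb R^{N_1}\to\mathbb R^{S+1}$ be affine, $\ell\in[L]$. Set $(\mathcal T_\ell,\mathcal W_\ell,\lambda_\ell,\kappa_\ell)=(T_\ell,W_\ell,0,0)$ for $\ell\le L$, $(0,0,1,0)$ for $\ell=L+1$ and $(0,-D,1,1)$ for $\ell=L+2$. The piecewise decision rule problem (PDR) is $$J^{\rm PDR}=\inf\ c^\top x+\theta+\tfrac1\delta\sup_{\mathbb P\in\mathcal P}\sum_{k}\mathbb P(\xi\in\Xi_k)\,\mathbb E_{\mathbb P}[\xi^\top Q_k\xi\mid\xi\in\Xi_k]$$ over $x\in\mathcal X$, $\theta\in\mathbb R$, $Y_k\in\mathbb R^{N_2\times(S+1)}$, $Q_k\in\mathbb R^{(S+1)\times(S+1)}$, subject to $$\mathcal T_\ell(x)^\top\xi\le(\mathcal W_\ell\xi)^\top Y_k\xi+\lambda_\ell\,\xi^\top Q_k\xi+\kappa_\ell\theta\qquad\forall\xi\in\Xi_k,\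 k\in[K],\ \ell\in[L+2].$$ **Theorem.** With $\Delta_\ell^k(x,Y_k,Q_k)=\frac12(\mathcal W_\ell^\top Y_k+Y_k^\top\mathcal W_\ell+\lambda_\ell Q_k+\lambda_\ell Q_k^\top-\mathcal T_\ell(x)\mathbf e_{S+1}^\top-\mathbf e_{S+1}\mathcal T_\ell(x)^\top)$, problem (PDR) is equivalent to the copositive program (COP) $$\inf\ c^\top x+\theta+\tfrac1\delta\big(\gamma\omega-\eta-2\hat p^\top r+2\omega\,\hat p^\top\mathbf e\big)$$ over $x\in\mathcal X$, $\theta,\eta\in\mathbb R$, $\omega\in\mathbb R_+$, $r,s,\alpha\in\mathbb R^K$, $\pi^k\in\mathbb R^{L+2}$, $Y_k\in\mathbb R^{N_2\times(S+1)}$, $Q_k\in\mathbb R^{(S+1)\times(S+1)}$, $B_k\in\mathbb S^{S+1}$, subject to, for all $k\in[K]$ and $\ell\in[L+2]$, $$s_k+\eta\le\omega,\qquad \sqrt{4r_k^2+(s_k+\eta)^2}\le2\omega-s_k-\eta,$$ $$\alpha_k+\mathrm{tr}(Q_k\hat\Omega_k)+\mathrm{tr}(B_k\hat\Omega_k)+\epsilon_k\|Q_k^\top+B_k\|_F\le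 s_k,$$ $$\pi^k_\ell+\kappa_\ell\theta\ge0,\qquad \Delta^k_\ell(x,Y_k,Q_k)-\pi^k_\ell\,\mathbf e_{S+1}\mathbf e_{S+1}^\top\in\mathcal C(\mathcal K_k),\qquad B_k+\alpha_k\,\mathbf e_{S+1}\mathbf e_{S+1}^\top\in\mathcal C(\mathcal K_k).$$ That is: 1. The optimal values of (PDR) and (COP) in $[-\infty,\infty]$ coincide. 2. If a point is feasible in (COP), then its components $(x,\theta,Y,Q)$ are feasible in (PDR), with an objective value that is no larger. 3. The objective value in (PDR) of a feasible $(x,\theta,Y,Q)$ is the infimum of the objective of (COP) over all feasible points with components $(x,\theta,Y,\frac12(Q+Q^\top))$, where $\frac12(Q+Q^\top)$ means that each $Q_k$ is replaced by $\frac12(Q_k+Q_k^\top)$. 4. (COP) has polynomial size. With the matrices $B_k$ counted as $(S+1)^2$ entries and a symmetry constraint, it has $N_1+3+K\,(3+(L+2)+N_2(S+1)+2(S+1)^2)$ scalar variables and, apart from $x\in\mathcal X$, $1+K(2(L+2)+5)$ constraints. -/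

import Mathlib

open MeasureTheory Matrix

noncomputable section

namespace PDR

/-- Vectors `ξ = (ζ, ν) ∈ ℝ^S × ℝ`; the last coordinate is `ν = e_{S+1}ᵀ ξ`. -/
abbrev Vec (n : ℕ) : Type := Fin n → ℝ

/-- Euclidean distance. -/
def euclDist {n : ℕ} (u v : Vec n) : ℝ := √(∑ j, (u j - v j) ^ 2)

/-- Frobenius norm. -/
def frob {n : ℕ} (A : Matrix (Fin n) (Fin n) ℝ) : ℝ := √(∑ i, ∑ j, A i j ^ 2)

/-- The quadratic form `ξᵀ A ξ`. -/
def quad {n : ℕ} (A : Matrix (Fin n) (Fin n) ℝ) (ξ : Vec n) : ℝ := ξ ⬝ᵥ (A *ᵥ ξ)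

/-- The generalized copositive cone `𝒞(𝒦)`. -/
def copositive {n : ℕ} (𝒦 : Set (Vec n)) : Set (Matrix (Fin n) (Fin n) ℝ) :=
  {X | X.IsSymm ∧ ∀ v ∈ 𝒦, 0 ≤ quad X v}

/-- The matrix `E_P[ξ ξᵀ]`. -/
def secondMoment {n : ℕ} (P : Measure (Vec n)) : Matrix (Fin n) (Fin n) ℝ :=
  Matrix.of fun i j => ∫ ξ, ξ i * ξ j ∂P

/-- The set `𝒫(A)` of Borel probability measures supported on `A`. -/
def probOn {n : ℕ} (A : Set (Vec n)) : Set (Measure (Vec n)) :=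
  {P | IsProbabilityMeasure P ∧ P Aᶜ = 0}

/-- The last standard basis vector `e_{S+1}`. -/
def eLast (S : ℕ) : Vec (S + 1) := Pi.single (Fin.last S) 1

/-- The data of the two-stage problem, of the partition and of the ambiguity set. -/
structure Data (N₁ N₂ S L K N : ℕ) where
  /-- first-stage feasible set -/
  X : Set (Vec N₁)
  /-- first-stage cost -/
  c : Vec N₁
  /-- second-stage cost matrix -/
  D : Matrix (Fin N₂) (Fin (S + 1)) ℝ
  /-- random recourse matrices -/
  W : Fin L → Matrix (Fin N₂) (Fin (S + 1)) ℝ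
  /-- right-hand sides, affine in the first-stage decision -/
  T : Fin L → (Vec N₁ →ᵃ[ℝ] Vec (S + 1))
  /-- risk level of the CVaR -/
  δ : ℝ
  /-- the convex cone whose slice is the support set -/
  cone : ConvexCone ℝ (Vec (S + 1))
  /-- constructor points of the Voronoi diagram -/
  gen : Fin K → Vec (S + 1)
  /-- the cells of the partition -/
  cell : Fin K → Set (Vec (S + 1))
  /-- historical samples -/
  sample : Fin N → Vec (S + 1)
  /-- radius of the `χ²`-ball -/
  γ : ℝ
  /-- radii of the Frobenius balls -/
  ε : Fin K → ℝ

/-- Decision variables of the piecewise decision rule problem. -/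
structure Point (N₁ N₂ S K : ℕ) where
  x : Vec N₁
  θ : ℝ
  Y : Fin K → Matrix (Fin N₂) (Fin (S + 1)) ℝ
  Q : Fin K → Matrix (Fin (S + 1)) (Fin (S + 1)) ℝ

/-- The same point with every `Q_k` replaced by its symmetric part. -/
def Point.symm {N₁ N₂ S K : ℕ} (z : Point N₁ N₂ S K) : Point N₁ N₂ S K :=
  { z with Q := fun k => (1 / 2 : ℝ) • (z.Q k + (z.Q k)ᵀ) }

/-- The index set `[L+2]`: `inl ℓ` is `ℓ ∈ [L]`, `inr 0` is `L+1`, `inr 1` is `L+2`. -/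
abbrev Row (L : ℕ) : Type := Fin L ⊕ Fin 2

namespace Data

variable {N₁ N₂ S L K N : ℕ} (d : Data N₁ N₂ S L K N)

/-- The support set `Ξ`. -/
def support : Set (Vec (S + 1)) := {ξ | ξ ∈ d.cone ∧ ξ (Fin.last S) = 1}

/-- The closed Voronoi region of the `k`-th constructor point in `Ξ`. -/
def voronoi (k : Fin K) : Set (Vec (S + 1)) :=
  {ξ | ξ ∈ d.support ∧ ∀ i, i ≠ k → euclDist ξ (d.gen k) ≤ euclDist ξ (d.gen i)}

/-- The cells are measurable subsets of the closed Voronoi regions and cover `Ξ`. Thus every point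
with only one nearest constructor point lies in exactly the cell of that point; the points with
several nearest constructor points may be allotted to all of their regions (which gives the closed
Voronoi regions) or to any one of them (which gives disjoint cells). -/
structure IsVoronoiPartition : Prop where
  measurable : ∀ k, MeasurableSet (d.cell k)
  cover : ⋃ k, d.cell k = d.support
  nearest : ∀ k, d.cell k ⊆ d.voronoi k

/-- The convex cone `𝒦_k` of the `k`-th Voronoi region. -/
def cellCone (k : Fin K) : Set (Vec (S + 1)) :=
  {ξ | ξ ∈ d.cone ∧ ∀ i, i ≠ k →
    2 * ((d.gen i - d.gen k) ⬝ᵥ ξ) ≤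
      (d.gen i ⬝ᵥ d.gen i - d.gen k ⬝ᵥ d.gen k) * ξ (Fin.last S)}

open Classical in
/-- The indices `ℐ_k` of the samples in the `k`-th cell. -/
def idx (k : Fin K) : Finset (Fin N) := Finset.univ.filter fun i => d.sample i ∈ d.cell k

/-- Empirical cell probabilities. -/
def pHat (k : Fin K) : ℝ := (1 / (N : ℝ)) * ((d.idx k).card : ℝ)

/-- Empirical conditional distributions. -/
def empirical (k : Fin K) : Measure (Vec (S + 1)) :=
  ((d.idx k).card : ENNReal)⁻¹ • ∑ i ∈ d.idx k, Measure.dirac (d.sample i)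

/-- Empirical second-moment matrices `|ℐ_k|⁻¹ ∑ ξ̂_i ξ̂_iᵀ`. -/
def omegaHat (k : Fin K) : Matrix (Fin (S + 1)) (Fin (S + 1)) ℝ :=
  (1 / ((d.idx k).card : ℝ)) • ∑ i ∈ d.idx k, vecMulVec (d.sample i) (d.sample i)

/-- The `χ²`-ball of cell probabilities. The second condition is the usual convention
`0 / 0 = 0` and `a / 0 = ∞` for `a > 0`. -/
def chiBall : Set (Fin K → ℝ) :=
  {p | (∀ k, 0 ≤ p k) ∧ (∀ k, p k = 0 → d.pHat k = 0) ∧ ∑ k, p k = 1 ∧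
    ∑ k, (p k - d.pHat k) ^ 2 / p k ≤ d.γ}

/-- The conditional ambiguity sets `𝒫_k`. -/
def condAmbiguity (k : Fin K) : Set (Measure (Vec (S + 1))) :=
  {P | P ∈ probOn (d.cell k) ∧ frob (secondMoment P - secondMoment (d.empirical k)) ≤ d.ε k}

/-- The two-layer ambiguity set `𝒫`. The last condition says that the cells are a partition up to
`P`-null sets; it holds for all mixtures if the cells are disjoint. -/
def ambiguity : Set (Measure (Vec (S + 1))) :=
  {P | P ∈ probOn d.support ∧
    (∃ p ∈ d.chiBall, ∃ Pc : Fin K → Measure (Vec (S + 1)),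
      (∀ k, Pc k ∈ d.condAmbiguity k) ∧ P = ∑ k, ENNReal.ofReal (p k) • Pc k) ∧
    ∀ i k, i ≠ k → P (d.cell i ∩ d.cell k) = 0}

/-- `𝒯_ℓ(x)`. -/
def rowT : Row L → Vec N₁ → Vec (S + 1)
  | .inl l, x => d.T l x
  | .inr _, _ => 0

/-- `𝒲_ℓ`. -/
def rowW : Row L → Matrix (Fin N₂) (Fin (S + 1)) ℝ
  | .inl l => d.W l
  | .inr 0 => 0
  | .inr 1 => -d.D

end Data

/-- `λ_ℓ`. -/
def rowLam {L : ℕ} : Row L → ℝ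
  | .inl _ => 0
  | .inr _ => 1

/-- `κ_ℓ`. -/
def rowKap {L : ℕ} : Row L → ℝ
  | .inl _ => 0
  | .inr 0 => 0
  | .inr 1 => 1

namespace Data

variable {N₁ N₂ S L K N : ℕ} (d : Data N₁ N₂ S L K N)

/-- Feasibility in the piecewise decision rule problem. -/
def Feasible (z : Point N₁ N₂ S K) : Prop :=
  z.x ∈ d.X ∧ ∀ l : Row L, ∀ k, ∀ ξ ∈ d.cell k,
    d.rowT l z.x ⬝ᵥ ξ ≤
      (d.rowW l *ᵥ ξ) ⬝ᵥ (z.Y k *ᵥ ξ) + rowLam l * quad (z.Q k) ξ + rowKap l * z.θ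

/-- `∑_k P(ξ ∈ Ξ_k) E_P[ξᵀ Q_k ξ | ξ ∈ Ξ_k]`. -/
def expectedCost (Q : Fin K → Matrix (Fin (S + 1)) (Fin (S + 1)) ℝ)
    (P : Measure (Vec (S + 1))) : ℝ :=
  ∑ k, P.real (d.cell k) * ∫ ξ, quad (Q k) ξ ∂(ProbabilityTheory.cond P (d.cell k))

/-- Objective of the piecewise decision rule problem. -/
def objective (z : Point N₁ N₂ S K) : EReal :=
  ((d.c ⬝ᵥ z.x + z.θ : ℝ) : EReal) +
    ((1 / d.δ : ℝ) : EReal) * ⨆ P ∈ d.ambiguity, ((d.expectedCost z.Q P : ℝ) : EReal)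

/-- The optimal value `J^PDR` of the piecewise decision rule problem. -/
def optimalValue : EReal := ⨅ z, ⨅ (_ : d.Feasible z), d.objective z

end Data

/-- The scalar variables of the copositive program. -/
inductive CopVar (N₁ N₂ S L K : ℕ) : Type
  | x (i : Fin N₁)
  | θ
  | η
  | ω
  | r (k : Fin K)
  | s (k : Fin K)
  | α (k : Fin K)
  | π (k : Fin K) (l : Row L)
  | Y (k : Fin K) (i : Fin N₂) (j : Fin (S + 1))
  | Q (k : Fin K) (i j : Fin (S + 1))
  | B (k : Fin K) (i j : Fin (S + 1))

/-- A point of the copositive program: a value for each scalar variable. -/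
abbrev CopPoint (N₁ N₂ S L K : ℕ) : Type := CopVar N₁ N₂ S L K → ℝ

/-- The constraints of the copositive program, apart from `x ∈ 𝒳`. -/
inductive CopConstr (L K : ℕ) : Type
  | omegaNonneg
  | linear (k : Fin K)
  | secondOrder (k : Fin K)
  | frobenius (k : Fin K)
  | shift (k : Fin K) (l : Row L)
  | copositiveRow (k : Fin K) (l : Row L)
  | copositiveB (k : Fin K)
  | symmetricB (k : Fin K)

namespace CopPoint

variable {N₁ N₂ S L K : ℕ} (w : CopPoint N₁ N₂ S L K)

/-- The matrix `B_k`. -/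
def matB (k : Fin K) : Matrix (Fin (S + 1)) (Fin (S + 1)) ℝ := Matrix.of fun i j => w (.B k i j)

/-- The components `(x, θ, Y, Q)` of a point of the copositive program. -/
def toPoint : Point N₁ N₂ S K where
  x := fun i => w (.x i)
  θ := w .θ
  Y := fun k => Matrix.of fun i j => w (.Y k i j)
  Q := fun k => Matrix.of fun i j => w (.Q k i j)

end CopPoint

namespace Data

variable {N₁ N₂ S L K N : ℕ} (d : Data N₁ N₂ S L K N)

/-- The symmetric matrices `Δ^k_ℓ(x, Y_k, Q_k)`. -/
def delta (l : Row L) (x : Vec N₁) (Y : Matrix (Fin N₂) (Fin (S + 1)) ℝ)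
    (Q : Matrix (Fin (S + 1)) (Fin (S + 1)) ℝ) : Matrix (Fin (S + 1)) (Fin (S + 1)) ℝ :=
  (1 / 2 : ℝ) • ((d.rowW l)ᵀ * Y + Yᵀ * d.rowW l + rowLam l • Q + rowLam l • Qᵀ
    - vecMulVec (d.rowT l x) (eLast S) - vecMulVec (eLast S) (d.rowT l x))

/-- The meaning of each constraint of the copositive program. -/
def copHolds (w : CopPoint N₁ N₂ S L K) : CopConstr L K → Prop
  | .omegaNonneg => 0 ≤ w .ω
  | .linear k => w (.s k) + w .η ≤ w .ω
  | .secondOrder k =>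
      √(4 * w (.r k) ^ 2 + (w (.s k) + w .η) ^ 2) ≤ 2 * w .ω - w (.s k) - w .η
  | .frobenius k =>
      w (.α k) + trace (w.toPoint.Q k * d.omegaHat k) + trace (w.matB k * d.omegaHat k)
        + d.ε k * frob ((w.toPoint.Q k)ᵀ + w.matB k) ≤ w (.s k)
  | .shift k l => 0 ≤ w (.π k l) + rowKap l * w .θ
  | .copositiveRow k l =>
      d.delta l w.toPoint.x (w.toPoint.Y k) (w.toPoint.Q k)
        - w (.π k l) • vecMulVec (eLast S) (eLast S) ∈ copositive (d.cellCone k)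
  | .copositiveB k =>
      w.matB k + w (.α k) • vecMulVec (eLast S) (eLast S) ∈ copositive (d.cellCone k)
  | .symmetricB k => (w.matB k).IsSymm

/-- Feasibility in the copositive program. -/
def CopFeasible (w : CopPoint N₁ N₂ S L K) : Prop :=
  w.toPoint.x ∈ d.X ∧ ∀ i : CopConstr L K, d.copHolds w i

/-- Objective of the copositive program. -/
def copObjective (w : CopPoint N₁ N₂ S L K) : ℝ :=
  d.c ⬝ᵥ w.toPoint.x + w .θ + (1 / d.δ) *
    (d.γ * w .ω - w .η - 2 * ∑ k, d.pHat k * w (.r k) + 2 * w .ω * ∑ k, d.pHat k)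

/-- Optimal value of the copositive program. -/
def copValue : EReal :=
  ⨅ w : CopPoint N₁ N₂ S L K, ⨅ (_ : d.CopFeasible w), ((d.copObjective w : ℝ) : EReal)

end Data

end PDR

end

/-! The worst case over the ambiguity set splits into two layers. Since a mixture `∑ p_k P_k` in `𝒫`
does not charge overlaps of cells, its cost is `∑ p_k ∫ ξᵀ Q_k ξ dP_k` (`expectedCost_mixture`). The
supremum may thus be taken over each `P_k` separately and then over `p`, and each layer is dualized.

The outer layer maximizes a linear function over a `χ²`-ball. `chi_weak_duality` and
`chi_strong_duality` identify its dual in `ω, η, r`; the maximizer is found explicitly.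

In the inner layer both the cost and the ambiguity constraint depend only on `M = E[ξξᵀ]`. The
problem is to maximize a linear function of `M` over the convex set of attainable second moments
intersected with a Frobenius ball around `Ω̂_k`. Separation (`exists_dual_of_inter_ball`) gives the
multipliers, and testing them on Dirac measures turns them into the copositivity of `B_k + α_k e eᵀ`
(`exists_cond_dual`, with weak counterpart `integral_quad_le`).

On `Ξ` the last coordinate is 1, so each decision rule constraint is the sign of a quadratic form;
by homogeneity and continuity, nonnegativity on a cell is nonnegativity on its cone
(`quad_nonneg_of_pureCell`). Strong duality uses only measures on points of exactly one cell: their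
mixtures never charge an overlap, and these points are dense enough to control all of `𝒦_k`. It
holds up to an arbitrary error `e`, which suffices for equality of infima. -/

noncomputable section

namespace PDR

/-! ### Linear optimization over a `χ²`-ball -/

/-- Weak duality for the `χ²`-ball, one summand. -/
lemma chi_term_nonneg {p q a ω r : ℝ} (hp : 0 < p) (hq : 0 ≤ q) (ha : 0 ≤ a) (hω : 0 ≤ ω)
    (hr : r ^ 2 ≤ ω * a) : 0 ≤ p * a + ω * (q ^ 2 / p) - 2 * q * r := by
  have h1 : 0 ≤ (p * a) * p + ω * q ^ 2 - 2 * q * r * p := by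
    have h2 : r ≤ √ω * √a := by
      rw [← Real.sqrt_mul hω]; exact Real.le_sqrt_of_sq_le hr
    have h3 : q * p * r ≤ q * p * (√ω * √a) := by gcongr
    have h4 : (√a * p - √ω * q) ^ 2 = a * p ^ 2 + ω * q ^ 2 - 2 * (q * p * (√ω * √a)) := by
      linear_combination p ^ 2 * Real.sq_sqrt ha + q ^ 2 * Real.sq_sqrt hω
    linarith [sq_nonneg (√a * p - √ω * q)]
  have h4 : p * a + ω * (q ^ 2 / p) - 2 * q * r =
      ((p * a) * p + ω * q ^ 2 - 2 * q * r * p) / p := by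
    field_simp
  rw [h4]; positivity

lemma chi_term_eq {p q : ℝ} (hp : p ≠ 0) : (p - q) ^ 2 / p = p - 2 * q + q ^ 2 / p := by
  field_simp; ring

/-- Weak duality for linear optimization over a `χ²`-ball. -/
lemma chi_weak_duality {ι : Type*} [Fintype ι] {p q s r : ι → ℝ} {γ ω η : ℝ}
    (hp : ∀ k, 0 < p k) (hq : ∀ k, 0 ≤ q k) (hps : ∑ k, p k = 1) (hqs : ∑ k, q k = 1)
    (hchi : ∑ k, (p k - q k) ^ 2 / p k ≤ γ) (hω : 0 ≤ ω) (hs : ∀ k, s k + η ≤ ω)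
    (hr : ∀ k, r k ^ 2 ≤ ω * (ω - s k - η)) :
    ∑ k, p k * s k ≤ γ * ω - η - 2 * ∑ k, q k * r k + 2 * ω * ∑ k, q k := by
  have h1 : 0 ≤ ∑ k, (p k * (ω - s k - η) + ω * (q k ^ 2 / p k) - 2 * q k * r k) :=
    Finset.sum_nonneg fun k _ =>
      chi_term_nonneg (hp k) (hq k) (by linarith [hs k]) hω (hr k)
  have h2 : ∑ k, (p k * (ω - s k - η) + ω * (q k ^ 2 / p k) - 2 * q k * r k) =
      ω * (∑ k, p k) - (∑ k, p k * s k) - η * (∑ k, p k) + ω * (∑ k, q k ^ 2 / p k)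
        - 2 * ∑ k, q k * r k := by
    simp only [Finset.mul_sum, ← Finset.sum_sub_distrib, ← Finset.sum_add_distrib]
    exact Finset.sum_congr rfl fun k _ => by ring
  have h3 : ∑ k, (p k - q k) ^ 2 / p k = 1 - 2 * 1 + ∑ k, q k ^ 2 / p k := by
    rw [Finset.sum_congr rfl fun k _ => chi_term_eq (q := q k) (hp k).ne']
    simp only [Finset.sum_add_distrib, Finset.sum_sub_distrib, ← Finset.mul_sum, hps, hqs]
  rw [hps] at h2
  rw [h3] at hchi
  rw [hqs]
  nlinarith [mul_le_mul_of_nonneg_right hchi hω]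

/-- The multiplier of the normalization constraint in the `χ²`-ball problem. -/
lemma exists_chi_multiplier {ι : Type*} [Fintype ι] {q a : ι → ℝ} {γ : ℝ}
    (hq : ∀ k, 0 < q k) (hqs : ∑ k, q k = 1) (hγ : 0 < γ) (ha : ∀ k, 0 ≤ a k) {m j : ι}
    (hm : a m = 0) (hj : 0 < a j) :
    ∃ t, 0 < t ∧ (∑ k, q k / √(t + a k)) * (∑ k, q k * √(t + a k)) = 1 + γ := by
  -- Intermediate values: near 0 the summand of `m` makes the first factor blow up, as `a m = 0`,
  -- while `q j * √(a j)` bounds the second factor from below. For large `t` the product approaches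
  -- 1.
  set G : ℝ → ℝ := fun t => (∑ k, q k / √(t + a k)) * (∑ k, q k * √(t + a k)) with hG
  have hcont : ContinuousOn G (Set.Ioi 0) := by
    refine ContinuousOn.mul ?_ ?_
    · refine continuousOn_finsetSum _ fun k _ => ContinuousOn.div (by fun_prop) (by fun_prop) ?_
      intro t ht
      have : 0 < t + a k := add_pos_of_pos_of_nonneg ht (ha k)
      positivity
    · fun_prop
  -- a point with a large value
  set t₁ : ℝ := (q m * q j * √(a j) / (1 + γ)) ^ 2 with ht₁
  have hu : 0 < q m * q j * √(a j) / (1 + γ) := by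
    have := hq m; have := hq j; positivity
  have ht₁0 : 0 < t₁ := by positivity
  have h₁ : 1 + γ ≤ G t₁ := by
    have e1 : q m / √t₁ ≤ ∑ k, q k / √(t₁ + a k) := by
      have := Finset.single_le_sum (f := fun k => q k / √(t₁ + a k))
        (fun k _ => div_nonneg (hq k).le (Real.sqrt_nonneg _)) (Finset.mem_univ m)
      simpa [hm] using this
    have e2 : q j * √(a j) ≤ ∑ k, q k * √(t₁ + a k) := by
      have := Finset.single_le_sum (f := fun k => q k * √(t₁ + a k))
        (fun k _ => mul_nonneg (hq k).le (Real.sqrt_nonneg _)) (Finset.mem_univ j)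
      refine le_trans (mul_le_mul_of_nonneg_left (Real.sqrt_le_sqrt ?_) (hq j).le) this
      linarith
    have e3 : q m / √t₁ * (q j * √(a j)) = 1 + γ := by
      rw [ht₁, Real.sqrt_sq hu.le]
      have := (hq m).ne'; have := (hq j).ne'; have := (Real.sqrt_pos.2 hj).ne'
      field_simp
    rw [← e3]
    exact mul_le_mul e1 e2 (mul_nonneg (hq j).le (Real.sqrt_nonneg _))
      (le_trans (div_nonneg (hq m).le (Real.sqrt_nonneg _)) e1)
  -- a point with a small value
  set A : ℝ := ∑ k, a k with hA
  have hle : ∀ k, a k ≤ A := fun k => Finset.single_le_sum (fun k _ => ha k) (Finset.mem_univ k)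
  have hA0 : 0 < A := lt_of_lt_of_le hj (hle j)
  set t₂ : ℝ := A / γ with ht₂
  have ht₂0 : 0 < t₂ := by positivity
  have h₂ : G t₂ ≤ 1 + γ := by
    have e1 : ∑ k, q k / √(t₂ + a k) ≤ 1 / √t₂ := by
      rw [← hqs, Finset.sum_div]
      refine Finset.sum_le_sum fun k _ => ?_
      have := hq k
      have := ha k
      gcongr
      linarith
    have e2 : ∑ k, q k * √(t₂ + a k) ≤ √(t₂ + A) := by
      calc ∑ k, q k * √(t₂ + a k) ≤ ∑ k, q k * √(t₂ + A) := by
            refine Finset.sum_le_sum fun k _ => ?_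
            have := hq k
            have := hle k
            gcongr
        _ = √(t₂ + A) := by rw [← Finset.sum_mul, hqs, one_mul]
    -- The choice `t₂ = A / γ` makes this product equal to `√(1 + γ)`.
    have e3 : 1 / √t₂ * √(t₂ + A) ≤ 1 + γ := by
      have : t₂ + A = t₂ * (1 + γ) := by rw [ht₂]; field_simp
      rw [this, Real.sqrt_mul ht₂0.le]
      have h0 := (Real.sqrt_pos.2 ht₂0).ne'
      have : 1 / √t₂ * (√t₂ * √(1 + γ)) = √(1 + γ) := by field_simp
      rw [this]
      exact Real.sqrt_le_iff.2 ⟨by linarith, by nlinarith⟩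
    refine le_trans (mul_le_mul e1 e2 ?_ (by positivity)) e3
    exact Finset.sum_nonneg fun k _ => mul_nonneg (hq k).le (Real.sqrt_nonneg _)
  obtain ⟨t, ht, h⟩ := isPreconnected_Ioi.intermediate_value
    (Set.mem_Ioi.2 ht₂0) (Set.mem_Ioi.2 ht₁0) hcont ⟨h₂, h₁⟩
  exact ⟨t, ht, h⟩

/-- Strong duality with attainment for a `χ²`-ball of positive radius. -/
lemma chi_strong_duality_of_pos {ι : Type*} [Fintype ι] {q : ι → ℝ} (s : ι → ℝ) {γ : ℝ}
    (hq : ∀ k, 0 < q k) (hqs : ∑ k, q k = 1) (hγ : 0 < γ) :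
    ∃ (p r : ι → ℝ) (ω η : ℝ), (∀ k, 0 < p k) ∧ ∑ k, p k = 1 ∧
      ∑ k, (p k - q k) ^ 2 / p k ≤ γ ∧ 0 ≤ ω ∧ (∀ k, s k + η ≤ ω) ∧
      (∀ k, r k ^ 2 ≤ ω * (ω - s k - η)) ∧
      γ * ω - η - 2 * ∑ k, q k * r k + 2 * ω * ∑ k, q k ≤ ∑ k, p k * s k := by
  have hne : Nonempty ι := by
    by_contra h
    rw [not_nonempty_iff] at h
    simp at hqs
  obtain ⟨m, hm⟩ := Finite.exists_max s
  -- For constant `s` every `p` has the same value, so `q` is optimal with `ω = 0`. Otherwise the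
  -- multiplier equation is solvable.
  by_cases hconst : ∀ k, s k = s m
  · refine ⟨q, 0, 0, -s m, hq, hqs, by simpa using hγ.le, le_rfl, fun k => by simp [hconst k],
      fun k => by simp, ?_⟩
    simp [hconst, ← Finset.sum_mul, hqs]
  push Not at hconst
  obtain ⟨j, hj⟩ := hconst
  have hj' : s j < s m := lt_of_le_of_ne (hm j) hj
  obtain ⟨t, ht, hG⟩ := exists_chi_multiplier (a := fun k => s m - s k) hq hqs hγ
    (fun k => sub_nonneg.2 (hm k)) (m := m) (j := j) (sub_self _) (sub_pos.2 hj')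
  -- Stationarity of the Lagrangian makes the optimal `p k` proportional to `q k / b k`, and `H`
  -- normalizes it. Its `χ²`-distance from `q` is `H * U - 1`, so the equation for `t` says that it
  -- lies on the boundary of the ball.
  set b : ι → ℝ := fun k => √(t + (s m - s k)) with hb
  have hb0 : ∀ k, 0 < b k := fun k => Real.sqrt_pos.2 (by linarith [hm k])
  have hbsq : ∀ k, b k ^ 2 = t + (s m - s k) := fun k => Real.sq_sqrt (by linarith [hm k])
  set H : ℝ := ∑ k, q k / b k with hH
  have hH0 : 0 < H := Finset.sum_pos (fun k _ => div_pos (hq k) (hb0 k)) Finset.univ_nonempty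
  set U : ℝ := ∑ k, q k * b k with hU
  have hHU : H * U = 1 + γ := hG
  have hps : ∑ k, q k / (b k * H) = 1 := by
    have : ∑ k, q k / (b k * H) = H / H := by
      rw [hH, Finset.sum_div]
      exact Finset.sum_congr rfl fun k _ => by rw [div_div]
    rw [this, div_self hH0.ne']
  have hs : ∀ k, s k = s m + t - b k ^ 2 := fun k => by rw [hbsq]; ring
  -- With these multipliers `ω - s k - η = b k ^ 2`, and every inequality in the proof of weak
  -- duality is tight.
  refine ⟨fun k => q k / (b k * H), fun k => b k / H, 1 / H ^ 2, 1 / H ^ 2 - (s m + t),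
    fun k => div_pos (hq k) (mul_pos (hb0 k) hH0), hps, ?_, by positivity, fun k => ?_,
    fun k => ?_, ?_⟩
  · have e : ∀ k, (q k / (b k * H) - q k) ^ 2 / (q k / (b k * H)) =
        q k / (b k * H) - 2 * q k + H * (q k * b k) := fun k => by
      have := (hq k).ne'; have := (hb0 k).ne'
      field_simp
      ring
    simp only [e, Finset.sum_add_distrib, Finset.sum_sub_distrib, ← Finset.mul_sum, hps, hqs,
      ← hU, hHU]
    linarith
  · nlinarith [sq_nonneg (b k), hs k]
  · rw [hs k]
    refine le_of_eq ?_
    field_simp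
    ring
  · have e1 : ∑ k, q k * (b k / H) = U / H := by
      rw [hU, Finset.sum_div]
      exact Finset.sum_congr rfl fun k _ => by ring
    have e2 : ∑ k, q k / (b k * H) * s k = s m + t - U / H := by
      have : ∀ k, q k / (b k * H) * s k = q k / (b k * H) * (s m + t) - q k * b k / H :=
        fun k => by
          have := (hb0 k).ne'
          rw [hs k]
          field_simp
      simp only [this, Finset.sum_sub_distrib, ← Finset.sum_mul, hps, ← Finset.sum_div, ← hU,
        one_mul]
    rw [e1, e2, hqs]
    have e3 : U / H = (1 + γ) * (1 / H ^ 2) := by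
      rw [← hHU]; field_simp
    rw [e3]
    linarith

/-- Strong duality for linear optimization over a `χ²`-ball. -/
lemma chi_strong_duality {ι : Type*} [Fintype ι] {q : ι → ℝ} (s : ι → ℝ) {γ e : ℝ}
    (hq : ∀ k, 0 < q k) (hqs : ∑ k, q k = 1) (hγ : 0 ≤ γ) (he : 0 < e) :
    ∃ (p r : ι → ℝ) (ω η : ℝ), (∀ k, 0 < p k) ∧ ∑ k, p k = 1 ∧
      ∑ k, (p k - q k) ^ 2 / p k ≤ γ ∧ 0 ≤ ω ∧ (∀ k, s k + η ≤ ω) ∧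
      (∀ k, r k ^ 2 ≤ ω * (ω - s k - η)) ∧
      γ * ω - η - 2 * ∑ k, q k * r k + 2 * ω * ∑ k, q k ≤ ∑ k, p k * s k + e := by
  rcases hγ.eq_or_lt with rfl | hγ
  -- At radius 0 the dual is attained only for constant `s`. The multipliers for the radius `τ ^ 2`
  -- are used instead: the maximizer there is within `τ` of `q` in each coordinate, which changes
  -- the value by at most `τ * A ≤ e`.
  · set A : ℝ := ∑ k, |s k| with hA
    have hA0 : 0 ≤ A := Finset.sum_nonneg fun k _ => abs_nonneg _
    set τ : ℝ := e / (1 + A) with hτ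
    have hτ0 : 0 < τ := by positivity
    obtain ⟨p, r, ω, η, hp, hps, hchi, hω, hs, hr, hval⟩ :=
      chi_strong_duality_of_pos s hq hqs (pow_pos hτ0 2)
    refine ⟨q, r, ω, η, hq, hqs, by simp, hω, hs, hr, ?_⟩
    have hdiff : ∀ k, |p k - q k| ≤ τ := fun k => by
      refine abs_le_of_sq_le_sq ?_ hτ0.le
      have h1 : (p k - q k) ^ 2 / p k ≤ τ ^ 2 :=
        (Finset.single_le_sum (f := fun k => (p k - q k) ^ 2 / p k)
          (fun k _ => div_nonneg (sq_nonneg _) (hp k).le) (Finset.mem_univ k)).trans hchi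
      rw [div_le_iff₀ (hp k)] at h1
      have h2 : p k ≤ 1 := hps ▸ Finset.single_le_sum (fun k _ => (hp k).le) (Finset.mem_univ k)
      nlinarith [sq_nonneg τ]
    have h1 : ∑ k, p k * s k ≤ ∑ k, (q k * s k + τ * |s k|) := by
      refine Finset.sum_le_sum fun k _ => ?_
      have : (p k - q k) * s k ≤ τ * |s k| := (le_abs_self _).trans (by
        rw [abs_mul]; exact mul_le_mul_of_nonneg_right (hdiff k) (abs_nonneg _))
      linarith
    rw [Finset.sum_add_distrib, ← Finset.mul_sum, ← hA] at h1
    have h2 : τ * A ≤ e := by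
      rw [hτ, div_mul_eq_mul_div, div_le_iff₀ (by positivity)]
      nlinarith
    have h3 : 0 ≤ τ ^ 2 * ω := by positivity
    linarith
  · obtain ⟨p, r, ω, η, hp, hps, hchi, hω, hs, hr, hval⟩ :=
      chi_strong_duality_of_pos s hq hqs hγ
    exact ⟨p, r, ω, η, hp, hps, hchi, hω, hs, hr, by linarith⟩

/-- The second-order cone constraint as a quadratic inequality. -/
lemma sqrt_soc_le_iff {r a ω : ℝ} (hω : 0 ≤ ω) (ha : a ≤ ω) :
    √(4 * r ^ 2 + a ^ 2) ≤ 2 * ω - a ↔ r ^ 2 ≤ ω * (ω - a) := by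
  rw [Real.sqrt_le_iff]
  constructor
  · rintro ⟨-, h⟩; nlinarith
  · intro h; exact ⟨by linarith, by nlinarith⟩

/-! ### Quadratic forms and the Frobenius inner product -/

section Algebra
variable {n : ℕ}

lemma quad_eq_sum (A : Matrix (Fin n) (Fin n) ℝ) (ξ : Vec n) :
    quad A ξ = ∑ i, ∑ j, A i j * (ξ i * ξ j) := by
  simp only [quad, dotProduct, mulVec, Finset.mul_sum]
  exact Finset.sum_congr rfl fun i _ => Finset.sum_congr rfl fun j _ => by ring

lemma quad_add (A B : Matrix (Fin n) (Fin n) ℝ) (ξ : Vec n) :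
    quad (A + B) ξ = quad A ξ + quad B ξ := by
  simp [quad, add_mulVec, dotProduct_add]

lemma quad_sub (A B : Matrix (Fin n) (Fin n) ℝ) (ξ : Vec n) :
    quad (A - B) ξ = quad A ξ - quad B ξ := by
  simp [quad, sub_mulVec, dotProduct_sub]

lemma quad_smul (c : ℝ) (A : Matrix (Fin n) (Fin n) ℝ) (ξ : Vec n) :
    quad (c • A) ξ = c * quad A ξ := by
  simp [quad, smul_mulVec, dotProduct_smul]

lemma quad_smul_vec (c : ℝ) (A : Matrix (Fin n) (Fin n) ℝ) (ξ : Vec n) :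
    quad A (c • ξ) = c ^ 2 * quad A ξ := by
  simp [quad, mulVec_smul, dotProduct_smul, smul_dotProduct]; ring

lemma quad_transpose (A : Matrix (Fin n) (Fin n) ℝ) (ξ : Vec n) :
    quad Aᵀ ξ = quad A ξ := by
  rw [quad, mulVec_transpose, quad, dotProduct_mulVec, dotProduct_comm]

lemma quad_vecMulVec (u v ξ : Vec n) : quad (vecMulVec u v) ξ = (u ⬝ᵥ ξ) * (v ⬝ᵥ ξ) := by
  simp [quad, vecMulVec_mulVec, dotProduct_smul, dotProduct_comm ξ u, mul_comm]

lemma quad_transpose_mul {m : ℕ} (A B : Matrix (Fin m) (Fin n) ℝ) (ξ : Vec n) :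
    quad (Aᵀ * B) ξ = (A *ᵥ ξ) ⬝ᵥ (B *ᵥ ξ) := by
  rw [quad, ← mulVec_mulVec, dotProduct_mulVec, vecMul_transpose]

lemma quad_symmPart (A : Matrix (Fin n) (Fin n) ℝ) (ξ : Vec n) :
    quad ((1 / 2 : ℝ) • (A + Aᵀ)) ξ = quad A ξ := by
  rw [quad_smul, quad_add, quad_transpose]; ring

lemma continuous_quad (A : Matrix (Fin n) (Fin n) ℝ) : Continuous (quad A) := by
  simp only [funext (quad_eq_sum A)]
  fun_prop

lemma eLast_dot {S : ℕ} (ξ : Vec (S + 1)) : eLast S ⬝ᵥ ξ = ξ (Fin.last S) := by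
  simp [eLast]

lemma quad_eLast {S : ℕ} (ξ : Vec (S + 1)) :
    quad (vecMulVec (eLast S) (eLast S)) ξ = ξ (Fin.last S) ^ 2 := by
  rw [quad_vecMulVec, eLast_dot]; ring

lemma isSymm_eLast {S : ℕ} : (vecMulVec (eLast S) (eLast S)).IsSymm := by
  ext i j; simp [vecMulVec_apply, mul_comm]

/-- The Frobenius inner product. -/
def frobInner (A M : Matrix (Fin n) (Fin n) ℝ) : ℝ := ∑ i, ∑ j, A i j * M i j

lemma trace_mul_eq_frobInner (A M : Matrix (Fin n) (Fin n) ℝ) (hM : M.IsSymm) :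
    trace (A * M) = frobInner A M := by
  simp only [trace, diag_apply, mul_apply, frobInner]
  exact Finset.sum_congr rfl fun i _ => Finset.sum_congr rfl fun j _ => by rw [hM.apply]

lemma frobInner_transpose (A M : Matrix (Fin n) (Fin n) ℝ) (hM : M.IsSymm) :
    frobInner Aᵀ M = frobInner A M := by
  simp only [frobInner, transpose_apply]
  rw [Finset.sum_comm]
  exact Finset.sum_congr rfl fun i _ => Finset.sum_congr rfl fun j _ => by rw [hM.apply]

lemma frobInner_add (A B M : Matrix (Fin n) (Fin n) ℝ) :
    frobInner (A + B) M = frobInner A M + frobInner B M := by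
  simp [frobInner, add_mul, Finset.sum_add_distrib]

lemma frobInner_sub_right (A M M' : Matrix (Fin n) (Fin n) ℝ) :
    frobInner A (M - M') = frobInner A M - frobInner A M' := by
  simp [frobInner, mul_sub, Finset.sum_sub_distrib]

lemma frob_nonneg (A : Matrix (Fin n) (Fin n) ℝ) : 0 ≤ frob A := Real.sqrt_nonneg _

lemma frobInner_le (A M : Matrix (Fin n) (Fin n) ℝ) : frobInner A M ≤ frob A * frob M := by
  simp only [frobInner, frob, ← Fintype.sum_prod_type']
  exact Real.sum_mul_le_sqrt_mul_sqrt _ _ _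

end Algebra

/-! ### Constraint matrices, Voronoi cells and their cones -/

namespace Data
variable {N₁ N₂ S L K N : ℕ} (d : Data N₁ N₂ S L K N)

lemma quad_delta (l : Row L) (x : Vec N₁) (Y : Matrix (Fin N₂) (Fin (S + 1)) ℝ)
    (Q : Matrix (Fin (S + 1)) (Fin (S + 1)) ℝ) (ξ : Vec (S + 1)) :
    quad (d.delta l x Y Q) ξ = (d.rowW l *ᵥ ξ) ⬝ᵥ (Y *ᵥ ξ) + rowLam l * quad Q ξ
      - (d.rowT l x ⬝ᵥ ξ) * ξ (Fin.last S) := by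
  simp only [delta, quad_smul, quad_sub, quad_add, quad_transpose_mul, quad_vecMulVec,
    quad_transpose, eLast_dot]
  rw [dotProduct_comm (Y *ᵥ ξ)]
  ring

lemma isSymm_delta (l : Row L) (x : Vec N₁) (Y : Matrix (Fin N₂) (Fin (S + 1)) ℝ)
    (Q : Matrix (Fin (S + 1)) (Fin (S + 1)) ℝ) : (d.delta l x Y Q).IsSymm := by
  ext i j
  simp only [delta, transpose_apply, Matrix.smul_apply, Matrix.sub_apply, Matrix.add_apply,
    Matrix.mul_apply, vecMulVec_apply,
    smul_eq_mul]
  rw [Finset.sum_congr rfl fun k _ => mul_comm (Y k i) (d.rowW l k j),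
    Finset.sum_congr rfl fun k _ => mul_comm (d.rowW l k i) (Y k j)]
  ring

/-- The points of the `k`-th cell that are in no other cell. -/
def pureCell (k : Fin K) : Set (Vec (S + 1)) := {ξ | ξ ∈ d.cell k ∧ ∀ i, i ≠ k → ξ ∉ d.cell i}

lemma pureCell_subset (k : Fin K) : d.pureCell k ⊆ d.cell k := fun _ h => h.1

lemma measurableSet_pureCell (hpart : d.IsVoronoiPartition) (k : Fin K) :
    MeasurableSet (d.pureCell k) := by
  have : d.pureCell k = d.cell k ∩ ⋂ i, ⋂ (_ : i ≠ k), (d.cell i)ᶜ := by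
    ext ξ; simp [pureCell]
  rw [this]
  exact (hpart.measurable k).inter
    (MeasurableSet.iInter fun i => MeasurableSet.iInter fun _ => (hpart.measurable i).compl)

lemma cell_subset_support (hpart : d.IsVoronoiPartition) (k : Fin K) : d.cell k ⊆ d.support :=
  fun _ h => (hpart.nearest k h).1

lemma sample_mem_pureCell
    (hties : ∀ n i k, d.sample n ∈ d.cell i → d.sample n ∈ d.cell k → i = k)
    {n : Fin N} {k : Fin K} (h : d.sample n ∈ d.cell k) : d.sample n ∈ d.pureCell k :=
  ⟨h, fun i hi h' => hi (hties n i k h' h)⟩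

lemma euclDist_sq_sub (ξ u v : Vec (S + 1)) :
    ∑ j, (ξ j - v j) ^ 2 - ∑ j, (ξ j - u j) ^ 2 = (v ⬝ᵥ v - u ⬝ᵥ u) - 2 * ((v - u) ⬝ᵥ ξ) := by
  simp only [dotProduct, Finset.mul_sum, ← Finset.sum_sub_distrib, Pi.sub_apply]
  exact Finset.sum_congr rfl fun j _ => by ring

lemma euclDist_le_iff (ξ u v : Vec (S + 1)) :
    euclDist ξ u ≤ euclDist ξ v ↔ 2 * ((v - u) ⬝ᵥ ξ) ≤ v ⬝ᵥ v - u ⬝ᵥ u := by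
  rw [euclDist, euclDist, Real.sqrt_le_sqrt_iff (Finset.sum_nonneg fun _ _ => sq_nonneg _),
    ← sub_nonneg, euclDist_sq_sub, sub_nonneg]

lemma euclDist_lt_iff (ξ u v : Vec (S + 1)) :
    euclDist ξ u < euclDist ξ v ↔ 2 * ((v - u) ⬝ᵥ ξ) < v ⬝ᵥ v - u ⬝ᵥ u := by
  rw [euclDist, euclDist, Real.sqrt_lt_sqrt_iff (Finset.sum_nonneg fun _ _ => sq_nonneg _),
    ← sub_pos, euclDist_sq_sub, sub_pos]

lemma voronoi_subset_cellCone (k : Fin K) : d.voronoi k ⊆ d.cellCone k := by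
  rintro ξ ⟨hξ, h⟩
  refine ⟨hξ.1, fun i hi => ?_⟩
  rw [hξ.2, mul_one]
  exact (euclDist_le_iff _ _ _).1 (h i hi)

lemma mem_pureCell_of_strict (hpart : d.IsVoronoiPartition) {k : Fin K} {ξ : Vec (S + 1)}
    (hξ : ξ ∈ d.support) (h : ∀ i, i ≠ k → euclDist ξ (d.gen k) < euclDist ξ (d.gen i)) :
    ξ ∈ d.pureCell k := by
  have hnot : ∀ i, i ≠ k → ξ ∉ d.cell i := fun i hi hmem =>
    absurd ((hpart.nearest i hmem).2 k hi.symm) (not_le.2 (h i hi))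
  rw [← hpart.cover, Set.mem_iUnion] at hξ
  obtain ⟨i, hi⟩ := hξ
  have : i = k := by
    by_contra hne
    exact hnot i hne hi
  exact ⟨this ▸ hi, hnot⟩

/-- Differences of squared distances to two constructor points are affine in `ξ`. On the segment
from a point of the closed region to a strictly nearest point, the inequalities are therefore strict
except possibly at the starting point. -/
lemma voronoi_subset_closure_pureCell (hpart : d.IsVoronoiPartition) {k : Fin K}
    (hcell : ∃ ξ ∈ d.support, ∀ i, i ≠ k → euclDist ξ (d.gen k) < euclDist ξ (d.gen i)) :
    d.voronoi k ⊆ closure (d.pureCell k) := by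
  rintro ξ ⟨hξ, h⟩
  obtain ⟨ξ₀, hξ₀, h₀⟩ := hcell
  have hcont : Continuous fun t : ℝ => (1 - t) • ξ + t • ξ₀ := by fun_prop
  have hmem : ∀ t : ℝ, t ∈ Set.Ioo (0 : ℝ) 1 → (1 - t) • ξ + t • ξ₀ ∈ d.pureCell k := by
    rintro t ⟨ht0, ht1⟩
    refine d.mem_pureCell_of_strict hpart ⟨?_, ?_⟩ fun i hi => ?_
    · exact d.cone.add_mem (d.cone.smul_mem (by linarith) hξ.1) (d.cone.smul_mem ht0 hξ₀.1)
    · simp [hξ.2, hξ₀.2]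
    · have h1 := (euclDist_le_iff _ _ _).1 (h i hi)
      have h2 := (euclDist_lt_iff _ _ _).1 (h₀ i hi)
      rw [euclDist_lt_iff, dotProduct_add, dotProduct_smul, dotProduct_smul, smul_eq_mul,
        smul_eq_mul]
      nlinarith
  have hlim : Filter.Tendsto (fun t : ℝ => (1 - t) • ξ + t • ξ₀) (nhdsWithin 0 (Set.Ioi 0))
      (nhds ξ) := by
    have := (hcont.tendsto 0).mono_left (nhdsWithin_le_nhds (s := Set.Ioi 0))
    simpa using this
  refine mem_closure_of_tendsto hlim ?_
  filter_upwards [Ioo_mem_nhdsGT (zero_lt_one' ℝ)] with t ht using hmem t ht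

/-- A compact slice makes the cone pointed. -/
lemma eq_zero_of_last_eq_zero (hsupport : IsCompact d.support) (hne : d.support.Nonempty)
    {ξ : Vec (S + 1)} (hξ : ξ ∈ d.cone) (h0 : ξ (Fin.last S) = 0) : ξ = 0 := by
  obtain ⟨ξ₀, hξ₀⟩ := hne
  obtain ⟨R, hR⟩ := hsupport.isBounded.exists_norm_le
  by_contra hne
  have hpos : 0 < ‖ξ‖ := norm_pos_iff.2 hne
  have hR0 : 0 ≤ R := (norm_nonneg _).trans (hR ξ₀ hξ₀)
  -- This gives `t • ξ` the norm `2 * R + 1`, more than the diameter of the slice allows.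
  set t : ℝ := (2 * R + 1) / ‖ξ‖ with ht
  have ht0 : 0 < t := by positivity
  have hmem : ξ₀ + t • ξ ∈ d.support :=
    ⟨d.cone.add_mem hξ₀.1 (d.cone.smul_mem ht0 hξ), by simp [h0, hξ₀.2]⟩
  have h1 : ‖t • ξ‖ ≤ R + R := by
    calc ‖t • ξ‖ = ‖(ξ₀ + t • ξ) - ξ₀‖ := by congr 1; abel
      _ ≤ _ := (norm_sub_le _ _).trans (add_le_add (hR _ hmem) (hR _ hξ₀))
  rw [norm_smul, Real.norm_of_nonneg ht0.le, ht, div_mul_cancel₀ _ hpos.ne'] at h1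
  linarith

/-- A quadratic form that is nonnegative on the untied part of a cell is nonnegative on its cone. -/
lemma quad_nonneg_of_pureCell (hpart : d.IsVoronoiPartition) (hsupport : IsCompact d.support)
    (hcone_nonneg : ∀ ξ ∈ d.cone, 0 ≤ ξ (Fin.last S)) {k : Fin K}
    (hcell : ∃ ξ ∈ d.support, ∀ i, i ≠ k → euclDist ξ (d.gen k) < euclDist ξ (d.gen i))
    {A : Matrix (Fin (S + 1)) (Fin (S + 1)) ℝ} (h : ∀ ξ ∈ d.pureCell k, 0 ≤ quad A ξ) :
    ∀ v ∈ d.cellCone k, 0 ≤ quad A v := by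
  rintro v ⟨hv, hvk⟩
  rcases (hcone_nonneg v hv).eq_or_lt with h0 | h0
  · rw [d.eq_zero_of_last_eq_zero hsupport (let ⟨ξ, hξ, _⟩ := hcell; ⟨ξ, hξ⟩) hv h0.symm]
    simp [quad]
  · set c := v (Fin.last S) with hc
    have hmem : c⁻¹ • v ∈ d.voronoi k := by
      refine ⟨⟨d.cone.smul_mem (inv_pos.2 h0) hv, by simp [← hc, h0.ne']⟩, fun i hi => ?_⟩
      rw [euclDist_le_iff, dotProduct_smul, smul_eq_mul]
      have := hvk i hi
      calc 2 * (c⁻¹ * ((d.gen i - d.gen k) ⬝ᵥ v)) = c⁻¹ * (2 * ((d.gen i - d.gen k) ⬝ᵥ v)) := by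
            ring
        _ ≤ c⁻¹ * ((d.gen i ⬝ᵥ d.gen i - d.gen k ⬝ᵥ d.gen k) * c) := by
            have := inv_pos.2 h0
            gcongr
        _ = _ := by field_simp
    have hcl : closure (d.pureCell k) ⊆ {ξ | 0 ≤ quad A ξ} :=
      closure_minimal h (isClosed_le continuous_const (continuous_quad A))
    have := hcl (d.voronoi_subset_closure_pureCell hpart hcell hmem)
    have e : v = c • (c⁻¹ • v) := by rw [smul_smul, mul_inv_cancel₀ h0.ne', one_smul]
    rw [e, quad_smul_vec]
    exact mul_nonneg (sq_nonneg c) this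

end Data

/-! ### Second moments of measures with compact support -/

section Measures
variable {n : ℕ}

lemma ae_mem_of_probOn {A : Set (Vec n)} {P : Measure (Vec n)} (hP : P ∈ probOn A) :
    ∀ᵐ ξ ∂P, ξ ∈ A := by
  rw [ae_iff]; exact hP.2

lemma probOn_mono {A B : Set (Vec n)} (h : A ⊆ B) : probOn A ⊆ probOn B :=
  fun _ hP => ⟨hP.1, measure_mono_null (Set.compl_subset_compl.2 h) hP.2⟩

lemma integrable_of_probOn {A : Set (Vec n)} (hA : IsCompact A) {P : Measure (Vec n)}
    (hP : P ∈ probOn A) {f : Vec n → ℝ} (hf : Continuous f) : Integrable f P := by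
  have := hP.1
  have h : IntegrableOn f A P := hf.continuousOn.integrableOn_compact hA
  rwa [IntegrableOn, Measure.restrict_eq_self_of_ae_mem (ae_mem_of_probOn hP)] at h

lemma integral_quad {A : Set (Vec n)} (hA : IsCompact A) {P : Measure (Vec n)}
    (hP : P ∈ probOn A) (Q : Matrix (Fin n) (Fin n) ℝ) :
    ∫ ξ, quad Q ξ ∂P = frobInner Q (secondMoment P) := by
  simp only [quad_eq_sum, frobInner, secondMoment, of_apply]
  have hint : ∀ i j, Integrable (fun ξ : Vec n => Q i j * (ξ i * ξ j)) P := fun i j =>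
    integrable_of_probOn hA hP (by fun_prop)
  rw [integral_finsetSum _ fun i _ => integrable_finsetSum _ fun j _ => hint i j]
  refine Finset.sum_congr rfl fun i _ => ?_
  rw [integral_finsetSum _ fun j _ => hint i j]
  exact Finset.sum_congr rfl fun j _ => integral_const_mul _ _

lemma isSymm_secondMoment (P : Measure (Vec n)) : (secondMoment P).IsSymm := by
  ext i j; simp [secondMoment, mul_comm]

lemma mixture_mem_probOn {A : Set (Vec n)} {P P' : Measure (Vec n)} (hP : P ∈ probOn A)
    (hP' : P' ∈ probOn A) {a b : ℝ} (ha : 0 ≤ a) (hb : 0 ≤ b) (hab : a + b = 1) :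
    ENNReal.ofReal a • P + ENNReal.ofReal b • P' ∈ probOn A := by
  have := hP.1
  have := hP'.1
  refine ⟨⟨?_⟩, by simp [hP.2, hP'.2]⟩
  simp [← ENNReal.ofReal_add ha hb, hab]

lemma secondMoment_mixture {A : Set (Vec n)} (hA : IsCompact A) {P P' : Measure (Vec n)}
    (hP : P ∈ probOn A) (hP' : P' ∈ probOn A) {a b : ℝ} (ha : 0 ≤ a) (hb : 0 ≤ b) :
    secondMoment (ENNReal.ofReal a • P + ENNReal.ofReal b • P') =
      a • secondMoment P + b • secondMoment P' := by
  ext i j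
  have h : Continuous fun ξ : Vec n => ξ i * ξ j := by fun_prop
  simp only [secondMoment, of_apply, Matrix.add_apply, Matrix.smul_apply, smul_eq_mul]
  rw [integral_add_measure ((integrable_of_probOn hA hP h).smul_measure ENNReal.ofReal_ne_top)
    ((integrable_of_probOn hA hP' h).smul_measure ENNReal.ofReal_ne_top),
    integral_smul_measure, integral_smul_measure, ENNReal.toReal_ofReal ha,
    ENNReal.toReal_ofReal hb]
  rfl

lemma dirac_mem_probOn {A : Set (Vec n)} (hA : MeasurableSet A) {ξ : Vec n} (hξ : ξ ∈ A) :
    Measure.dirac ξ ∈ probOn A :=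
  ⟨inferInstance, by simp [Measure.dirac_apply' _ hA.compl, hξ]⟩

lemma secondMoment_dirac (ξ : Vec n) : secondMoment (Measure.dirac ξ) = vecMulVec ξ ξ := by
  ext i j; simp [secondMoment, vecMulVec_apply]

end Measures

/-! ### Empirical distributions and mixtures over the cells -/

namespace Data
variable {N₁ N₂ S L K N : ℕ} (d : Data N₁ N₂ S L K N)

lemma mem_idx {k : Fin K} {n : Fin N} : n ∈ d.idx k ↔ d.sample n ∈ d.cell k := by
  simp [idx]

lemma secondMoment_empirical (k : Fin K) : secondMoment (d.empirical k) = d.omegaHat k := by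
  ext i j
  simp only [secondMoment, empirical, omegaHat, of_apply, Matrix.smul_apply, Matrix.sum_apply,
    vecMulVec_apply, smul_eq_mul]
  rw [integral_smul_measure, integral_finsetSum_measure fun n _ => integrable_dirac enorm_lt_top]
  simp

lemma isSymm_omegaHat (k : Fin K) : (d.omegaHat k).IsSymm := by
  rw [← secondMoment_empirical]; exact isSymm_secondMoment _

lemma empirical_mem_probOn (hpart : d.IsVoronoiPartition)
    (hties : ∀ n i k, d.sample n ∈ d.cell i → d.sample n ∈ d.cell k → i = k)
    {k : Fin K} (hidx : (d.idx k).Nonempty) : d.empirical k ∈ probOn (d.pureCell k) := by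
  have hm := (d.measurableSet_pureCell hpart k).compl
  have hc : ((d.idx k).card : ENNReal) ≠ 0 := by simpa using hidx.ne_empty
  refine ⟨⟨?_⟩, ?_⟩
  · simp [empirical, ENNReal.inv_mul_cancel hc (ENNReal.natCast_ne_top _)]
  · simp only [empirical, Measure.smul_apply, Measure.finsetSum_apply, smul_eq_mul]
    rw [Finset.sum_eq_zero, mul_zero]
    intro n hn
    have := d.sample_mem_pureCell hties (d.mem_idx.1 hn)
    simp [Measure.dirac_apply' _ hm, this]

/-- An interior point stays in the cone when moved slightly along `-eLast`, so its last coordinate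
is positive and it can be rescaled into the slice. -/
lemma support_nonempty (hcone_nonneg : ∀ ξ ∈ d.cone, 0 ≤ ξ (Fin.last S))
    (hcone_full : (interior (d.cone : Set (Vec (S + 1)))).Nonempty) : d.support.Nonempty := by
  obtain ⟨ξ, hξ⟩ := hcone_full
  have hpos : 0 < ξ (Fin.last S) := by
    have hcont : Continuous fun t : ℝ => ξ - t • eLast S := by fun_prop
    have h0 : ∀ᶠ t in nhds (0 : ℝ), ξ - t • eLast S ∈ interior (d.cone : Set (Vec (S + 1))) :=
      (hcont.tendsto 0).eventually (isOpen_interior.mem_nhds (by simpa using hξ))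
    have h1 := h0.filter_mono (nhdsWithin_le_nhds (s := Set.Ioi 0))
    obtain ⟨t, ht, ht0⟩ := (h1.and self_mem_nhdsWithin).exists
    have := hcone_nonneg _ (interior_subset ht)
    simp [eLast] at this
    exact lt_of_lt_of_le ht0 this
  exact ⟨(ξ (Fin.last S))⁻¹ • ξ, d.cone.smul_mem (inv_pos.2 hpos) (interior_subset hξ),
    by simp [hpos.ne']⟩

lemma pHat_pos {k : Fin K} (hidx : (d.idx k).Nonempty) : 0 < d.pHat k := by
  have : 0 < N := Fin.pos hidx.choose
  have : 0 < (d.idx k).card := hidx.card_pos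
  rw [pHat]
  positivity

lemma sum_pHat (hpart : d.IsVoronoiPartition) (hne : d.support.Nonempty)
    (hsample : ∀ i, d.sample i ∈ d.support)
    (hties : ∀ n i k, d.sample n ∈ d.cell i → d.sample n ∈ d.cell k → i = k)
    (hidx : ∀ k, (d.idx k).Nonempty) : ∑ k, d.pHat k = 1 := by
  classical
  have hcard : ∑ k, ((d.idx k).card : ℝ) = N := by
    have e : ∀ k, ((d.idx k).card : ℝ) = ∑ n, if d.sample n ∈ d.cell k then (1 : ℝ) else 0 := by
      intro k
      rw [Finset.sum_boole]
      congr 2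
    simp only [e]
    rw [Finset.sum_comm]
    have e2 : ∀ n, (∑ k, if d.sample n ∈ d.cell k then (1 : ℝ) else 0) = 1 := by
      intro n
      have h := hsample n
      rw [← hpart.cover, Set.mem_iUnion] at h
      obtain ⟨k, hk⟩ := h
      rw [Finset.sum_eq_single k]
      · simp [hk]
      · intro i _ hi
        exact if_neg fun h' => hi (hties n i k h' hk)
      · simp
    simp [e2]
  -- A nonempty support forces a cell and hence a sample, so that `N ≠ 0`.
  obtain ⟨ξ, hξ⟩ := hne
  rw [← hpart.cover, Set.mem_iUnion] at hξ
  obtain ⟨k, -⟩ := hξ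
  have hN : 0 < N := Fin.pos (hidx k).choose
  simp only [pHat, ← Finset.mul_sum, hcard]
  field_simp

/-- Restricting a mixture of conditional distributions to a cell. -/
lemma restrict_mixture {p : Fin K → ℝ} (hp : ∀ k, 0 < p k)
    {Pc : Fin K → Measure (Vec (S + 1))} (hPc : ∀ k, Pc k ∈ probOn (d.cell k))
    (hnull : ∀ i k, i ≠ k →
      (∑ k, ENNReal.ofReal (p k) • Pc k) (d.cell i ∩ d.cell k) = 0) (k : Fin K) :
    (∑ k, ENNReal.ofReal (p k) • Pc k).restrict (d.cell k) = ENNReal.ofReal (p k) • Pc k := by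
  -- All weights are positive, so a null set of the mixture is null for each component. As `Pc j`
  -- lives on cell `j`, it sees cell `k` only through the overlap.
  have hoff : ∀ j, j ≠ k → (Pc j) (d.cell k) = 0 := by
    intro j hj
    have h := hnull j k hj
    simp only [Measure.finsetSum_apply, Measure.smul_apply, smul_eq_mul] at h
    have h1 := Finset.sum_eq_zero_iff.1 h j (Finset.mem_univ j)
    rw [mul_eq_zero] at h1
    have h2 : (Pc j) (d.cell j ∩ d.cell k) = 0 :=
      h1.resolve_left (by simpa using hp j)
    refine measure_mono_null (fun ξ hξ => ?_) (measure_union_null h2 (hPc j).2)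
    by_cases h : ξ ∈ d.cell j
    · exact Or.inl ⟨h, hξ⟩
    · exact Or.inr h
  ext A hA
  rw [Measure.restrict_apply hA, Measure.finsetSum_apply, Finset.sum_eq_single k]
  · rw [Measure.smul_apply, Measure.smul_apply, ← Measure.restrict_apply hA,
      Measure.restrict_eq_self_of_ae_mem (ae_mem_of_probOn (hPc k))]
  · intro j _ hj
    rw [Measure.smul_apply, measure_mono_null Set.inter_subset_right (hoff j hj), smul_zero]
  · simp

/-- The mixture restricted to the cell `k` is `p k • Pc k`, so its conditional distribution there is
`Pc k` itself. -/
lemma expectedCost_mixture (Q : Fin K → Matrix (Fin (S + 1)) (Fin (S + 1)) ℝ) {p : Fin K → ℝ} (hp : ∀ k, 0 < p k)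
    {Pc : Fin K → Measure (Vec (S + 1))} (hPc : ∀ k, Pc k ∈ probOn (d.cell k))
    (hnull : ∀ i k, i ≠ k →
      (∑ k, ENNReal.ofReal (p k) • Pc k) (d.cell i ∩ d.cell k) = 0) :
    d.expectedCost Q (∑ k, ENNReal.ofReal (p k) • Pc k) =
      ∑ k, p k * ∫ ξ, quad (Q k) ξ ∂(Pc k) := by
  refine Finset.sum_congr rfl fun k _ => ?_
  have hr := d.restrict_mixture hp hPc hnull k
  have := (hPc k).1
  have hm : (∑ k, ENNReal.ofReal (p k) • Pc k) (d.cell k) = ENNReal.ofReal (p k) := by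
    rw [← Measure.restrict_apply_univ, hr]; simp
  rw [Measure.real, ProbabilityTheory.cond, hm, hr, integral_smul_measure, integral_smul_measure,
    ENNReal.toReal_inv, ENNReal.toReal_ofReal (hp k).le]
  simp [(hp k).ne']

/-- Mixtures of conditional distributions without ties are in the ambiguity set. -/
lemma mixture_mem_ambiguity (hpart : d.IsVoronoiPartition) {p : Fin K → ℝ} (hp : p ∈ d.chiBall)
    {Pc : Fin K → Measure (Vec (S + 1))} (hPc : ∀ k, Pc k ∈ d.condAmbiguity k)
    (hpure : ∀ k, Pc k ∈ probOn (d.pureCell k)) :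
    ∑ k, ENNReal.ofReal (p k) • Pc k ∈ d.ambiguity := by
  refine ⟨⟨⟨?_⟩, ?_⟩, ⟨p, hp, Pc, hPc, rfl⟩, fun i k hik => ?_⟩
  · have : ∀ k, Pc k Set.univ = 1 := fun k => by have := (hpure k).1; simp
    simp [Measure.finsetSum_apply, this, ← ENNReal.ofReal_sum_of_nonneg (fun k _ => hp.1 k),
      hp.2.2.1]
  · rw [Measure.finsetSum_apply]
    refine Finset.sum_eq_zero fun k _ => ?_
    simp [(probOn_mono ((d.pureCell_subset k).trans (d.cell_subset_support hpart k))
      (hpure k)).2]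
  · rw [Measure.finsetSum_apply]
    refine Finset.sum_eq_zero fun j _ => ?_
    have : (Pc j) (d.cell i ∩ d.cell k) = 0 := by
      refine measure_mono_null ?_ (hpure j).2
      intro ξ hξ h
      rcases eq_or_ne i j with rfl | hij
      · exact h.2 k hik.symm hξ.2
      · exact h.2 i hij hξ.1
    simp [this]

end Data

/-! ### Separation for a convex set and a ball -/

/-- Duality for maximizing a linear function over the intersection of a bounded convex set with a
ball around one of its points. -/
lemma exists_dual_of_inter_ball {E : Type*} [NormedAddCommGroup E] [InnerProductSpace ℝ E]
    [FiniteDimensional ℝ E] {C : Set E} (hC : Convex ℝ C) (hb : Bornology.IsBounded C) {Ω : E}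
    (hΩ : Ω ∈ C) (Q : E) {ε e : ℝ} (hε : 0 ≤ ε) (he : 0 < e) :
    ∃ M ∈ C, ‖M - Ω‖ ≤ ε ∧ ∃ (V : E) (u : ℝ), (∀ M' ∈ C, inner ℝ V M' + inner ℝ Q M' ≤ u) ∧
      u - inner ℝ V Ω + ε * ‖V‖ ≤ inner ℝ Q M + e := by
  have hcontQ : Continuous fun M : E => inner ℝ Q M := by fun_prop
  have hcomp : IsCompact (closure C) := hb.isCompact_closure
  set F : Set ℝ := (fun M : E => inner ℝ Q M) '' (C ∩ Metric.closedBall Ω ε) with hF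
  have hFne : F.Nonempty := ⟨_, Ω, ⟨hΩ, Metric.mem_closedBall_self hε⟩, rfl⟩
  have hFbdd : BddAbove F :=
    (hcomp.image hcontQ).bddAbove.mono
      (Set.image_mono (Set.inter_subset_left.trans subset_closure))
  set val : ℝ := sSup F with hval
  have hle : ∀ M ∈ C, ‖M - Ω‖ ≤ ε → inner ℝ Q M ≤ val := fun M hM hMε =>
    le_csSup hFbdd ⟨M, ⟨hM, by simpa [dist_eq_norm] using hMε⟩, rfl⟩
  -- the bound extends to the closure
  have hlec : ∀ M ∈ closure C, ‖M - Ω‖ ≤ ε → inner ℝ Q M ≤ val := by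
    intro M hM hMε
    rcases hε.eq_or_lt with rfl | hε
    · have : M = Ω := by simpa [sub_eq_zero] using hMε
      rw [this]
      exact hle Ω hΩ (by simp)
    -- `C` need not be closed. Points of the closure in the open ball are limits of points of `C` in
    -- the ball; boundary points of the ball are then reached along the segment to `Ω`.
    have hball : ∀ N ∈ closure C, ‖N - Ω‖ < ε → inner ℝ Q N ≤ val := by
      intro N hN hNε
      have h1 : N ∈ closure (Metric.ball Ω ε ∩ C) :=
        Metric.isOpen_ball.inter_closure ⟨by simpa [dist_eq_norm] using hNε, hN⟩
      refine (closure_minimal ?_ (isClosed_le hcontQ continuous_const) h1 : N ∈ {N | _ ≤ val})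
      rintro N' ⟨hN', hN'C⟩
      exact hle N' hN'C (by rw [← dist_eq_norm]; exact (Metric.mem_ball.1 hN').le)
    have hcont : Continuous fun t : ℝ => inner ℝ Q ((1 - t) • M + t • Ω) := by fun_prop
    have hlim : Filter.Tendsto (fun t : ℝ => inner ℝ Q ((1 - t) • M + t • Ω))
        (nhdsWithin 0 (Set.Ioi 0)) (nhds (inner ℝ Q M)) := by
      have := (hcont.tendsto 0).mono_left (nhdsWithin_le_nhds (s := Set.Ioi 0))
      simpa using this
    refine le_of_tendsto hlim ?_
    filter_upwards [Ioo_mem_nhdsGT (zero_lt_one' ℝ)] with t ht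
    refine hball _ (hC.closure hM (subset_closure hΩ) (by linarith [ht.2]) ht.1.le (by ring)) ?_
    have : (1 - t) • M + t • Ω - Ω = (1 - t) • (M - Ω) := by module
    rw [this, norm_smul, Real.norm_of_nonneg (by linarith [ht.2])]
    nlinarith [ht.1, ht.2, norm_nonneg (M - Ω)]
  obtain ⟨_, ⟨M, ⟨hMC, hMΩ⟩, rfl⟩, hM⟩ :=
    exists_lt_of_lt_csSup hFne (show val - e / 3 < sSup F by rw [← hval]; linarith)
  refine ⟨M, hMC, by simpa [dist_eq_norm] using hMΩ, ?_⟩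
  -- The graph of the linear function over `closure C` is separated from the ball times a half-line
  -- that starts strictly above the optimal value.
  have hs₁ : Convex ℝ ((fun M : E => (M, inner ℝ Q M)) '' closure C) :=
    hC.closure.linear_image (LinearMap.prod LinearMap.id (innerₛₗ ℝ Q))
  have hs₂ : IsCompact ((fun M : E => (M, inner ℝ Q M)) '' closure C) :=
    hcomp.image (by fun_prop)
  have ht₁ : Convex ℝ (Metric.closedBall Ω ε ×ˢ Set.Ici (val + e / 3)) :=
    (convex_closedBall Ω ε).prod (convex_Ici _)
  have ht₂ : IsClosed (Metric.closedBall Ω ε ×ˢ Set.Ici (val + e / 3)) :=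
    Metric.isClosed_closedBall.prod isClosed_Ici
  have hdisj : Disjoint ((fun M : E => (M, inner ℝ Q M)) '' closure C)
      (Metric.closedBall Ω ε ×ˢ Set.Ici (val + e / 3)) := by
    rw [Set.disjoint_left]
    rintro _ ⟨N, hN, rfl⟩ ⟨h1, h2⟩
    have := hlec N hN (by simpa [dist_eq_norm] using h1)
    have h2 : val + e / 3 ≤ inner ℝ Q N := h2
    linarith
  obtain ⟨f, u, v, hfu, huv, hfv⟩ := geometric_hahn_banach_compact_closed hs₁ hs₂ ht₁ ht₂ hdisj
  set V : E := (InnerProductSpace.toDual ℝ E).symm (f.comp (ContinuousLinearMap.inl ℝ E ℝ))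
    with hV
  set τ : ℝ := f (0, 1) with hτ
  have hf : ∀ (N : E) (t : ℝ), f (N, t) = inner ℝ V N + τ * t := by
    intro N t
    have h1 : inner ℝ V N = f (N, 0) := by simp [hV]
    have h2 : ((N, t) : E × ℝ) = (N, 0) + t • ((0, 1) : E × ℝ) := by simp
    rw [h2, map_add, map_smul, h1, smul_eq_mul, mul_comm]
  have hA : ∀ N ∈ closure C, inner ℝ V N + τ * inner ℝ Q N < u := fun N hN => by
    rw [← hf]; exact hfu _ ⟨N, hN, rfl⟩
  have hB : ∀ N, ‖N - Ω‖ ≤ ε → v < inner ℝ V N + τ * (val + e / 3) := fun N hN => by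
    rw [← hf]; exact hfv _ ⟨by simpa [dist_eq_norm] using hN, Set.mem_Ici.2 le_rfl⟩
  -- The separating hyperplane is not vertical, since `Ω` lies in the projections of both sets. The
  -- gap `e / 3` thus replaces a Slater condition.
  have hτ0 : 0 < τ := by
    have h1 := hA Ω (subset_closure hΩ)
    have h2 := hB Ω (by simpa using hε)
    have h3 := hle Ω hΩ (by simpa using hε)
    by_contra hneg
    nlinarith
  have hN : u < inner ℝ V Ω - ε * ‖V‖ + τ * (val + e / 3) := by
    -- This point minimizes `inner ℝ V` over the ball. For `V = 0`, division by zero makes it `Ω`.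
    have h1 := hB (Ω - (ε / ‖V‖) • V) (by
      rw [sub_sub_cancel_left, norm_neg, norm_smul, Real.norm_of_nonneg (by positivity)]
      rcases eq_or_ne ‖V‖ 0 with h | h
      · simpa [h] using hε
      · rw [div_mul_cancel₀ _ h])
    have h2 : inner ℝ V (Ω - (ε / ‖V‖) • V) = inner ℝ V Ω - ε * ‖V‖ := by
      rw [inner_sub_right, inner_smul_right, real_inner_self_eq_norm_sq]
      rcases eq_or_ne ‖V‖ 0 with h | h
      · simp [h]
      · field_simp
    rw [h2] at h1
    linarith
  refine ⟨τ⁻¹ • V, τ⁻¹ * u, fun N hNC => ?_, ?_⟩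
  · rw [real_inner_smul_left]
    have := hA N (subset_closure hNC)
    calc τ⁻¹ * inner ℝ V N + inner ℝ Q N = τ⁻¹ * (inner ℝ V N + τ * inner ℝ Q N) := by
          field_simp
      _ ≤ τ⁻¹ * u := by
          have := inv_pos.2 hτ0
          gcongr
  · rw [real_inner_smul_left, norm_smul, Real.norm_of_nonneg (inv_pos.2 hτ0).le]
    have h1 : τ⁻¹ * u ≤ τ⁻¹ * (inner ℝ V Ω - ε * ‖V‖ + τ * (val + e / 3)) := by
      have := inv_pos.2 hτ0
      gcongr
    have h2 : τ⁻¹ * (inner ℝ V Ω - ε * ‖V‖ + τ * (val + e / 3)) =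
        τ⁻¹ * inner ℝ V Ω - ε * (τ⁻¹ * ‖V‖) + (val + e / 3) := by
      field_simp
    linarith

/-! ### Matrices as Euclidean vectors and bounds on second moments -/

section Frobenius
variable {n : ℕ}

/-- A matrix as a point of Euclidean space. -/
def toEuclidean (A : Matrix (Fin n) (Fin n) ℝ) : EuclideanSpace ℝ (Fin n × Fin n) :=
  WithLp.toLp 2 fun ij => A ij.1 ij.2

/-- A point of Euclidean space as a matrix. -/
def ofEuclidean (v : EuclideanSpace ℝ (Fin n × Fin n)) : Matrix (Fin n) (Fin n) ℝ :=
  Matrix.of fun i j => v (i, j)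

lemma inner_toEuclidean (v : EuclideanSpace ℝ (Fin n × Fin n)) (A : Matrix (Fin n) (Fin n) ℝ) :
    inner ℝ v (toEuclidean A) = frobInner (ofEuclidean v) A := by
  simp [PiLp.inner_apply, toEuclidean, ofEuclidean, frobInner, Fintype.sum_prod_type, mul_comm]

lemma ofEuclidean_toEuclidean (A : Matrix (Fin n) (Fin n) ℝ) : ofEuclidean (toEuclidean A) = A :=
  rfl

lemma norm_eq_frob (v : EuclideanSpace ℝ (Fin n × Fin n)) : ‖v‖ = frob (ofEuclidean v) := by
  simp [EuclideanSpace.norm_eq, ofEuclidean, frob, Fintype.sum_prod_type]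

lemma frob_neg (A : Matrix (Fin n) (Fin n) ℝ) : frob (-A) = frob A := by
  simp [frob]

/-- Convexity of the square. It allows a multiplier to be replaced by its symmetric part, which
pairs equally with symmetric matrices. -/
lemma frob_symmPart_le (A : Matrix (Fin n) (Fin n) ℝ) :
    frob ((1 / 2 : ℝ) • (A + Aᵀ)) ≤ frob A := by
  refine Real.sqrt_le_sqrt ?_
  have h : ∑ i, ∑ j, A i j ^ 2 = ∑ i, ∑ j, (1 / 2 * A i j ^ 2 + 1 / 2 * A j i ^ 2) := by
    simp only [Finset.sum_add_distrib, ← Finset.mul_sum]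
    rw [Finset.sum_comm (f := fun i j => A j i ^ 2)]
    ring
  rw [h]
  refine Finset.sum_le_sum fun i _ => Finset.sum_le_sum fun j _ => ?_
  simp only [Matrix.smul_apply, Matrix.add_apply, transpose_apply, smul_eq_mul]
  nlinarith [sq_nonneg (A i j - A j i)]

lemma frobInner_symmPart (A M : Matrix (Fin n) (Fin n) ℝ) (hM : M.IsSymm) :
    frobInner ((1 / 2 : ℝ) • (A + Aᵀ)) M = frobInner A M := by
  have h : ∀ B : Matrix (Fin n) (Fin n) ℝ, frobInner ((1 / 2 : ℝ) • B) M =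
      1 / 2 * frobInner B M := fun B => by
    simp [frobInner, Finset.mul_sum, mul_assoc]
  rw [h, frobInner_add, frobInner_transpose _ _ hM]
  ring

lemma frobInner_neg (A M : Matrix (Fin n) (Fin n) ℝ) : frobInner (-A) M = -frobInner A M := by
  simp [frobInner]

lemma frobInner_vecMulVec (A : Matrix (Fin n) (Fin n) ℝ) (ξ : Vec n) :
    frobInner A (vecMulVec ξ ξ) = quad A ξ := by
  simp [frobInner, quad_eq_sum, vecMulVec_apply]

lemma frob_secondMoment_le {A : Set (Vec n)} {R : ℝ}
    (hR : ∀ ξ ∈ A, ‖ξ‖ ≤ R) {P : Measure (Vec n)} (hP : P ∈ probOn A) :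
    frob (secondMoment P) ≤ √(∑ _i : Fin n, ∑ _j : Fin n, (R ^ 2) ^ 2) := by
  have := hP.1
  refine Real.sqrt_le_sqrt (Finset.sum_le_sum fun i _ => Finset.sum_le_sum fun j _ => ?_)
  have h : ‖∫ ξ, ξ i * ξ j ∂P‖ ≤ R ^ 2 * P.real Set.univ := by
    refine norm_integral_le_of_norm_le_const ?_
    filter_upwards [ae_mem_of_probOn hP] with ξ hξ
    rw [norm_mul, sq]
    exact mul_le_mul ((norm_le_pi_norm ξ i).trans (hR ξ hξ))
      ((norm_le_pi_norm ξ j).trans (hR ξ hξ)) (norm_nonneg _) ((norm_nonneg _).trans (hR ξ hξ))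
  simp only [probReal_univ, mul_one] at h
  rw [secondMoment, of_apply, ← sq_abs]
  exact pow_le_pow_left₀ (abs_nonneg _) h 2

end Frobenius

/-! ### Duality in one cell -/

namespace Data
variable {N₁ N₂ S L K N : ℕ} (d : Data N₁ N₂ S L K N)

/-- Strong duality for the conditional worst-case expectation in one cell. -/
lemma exists_cond_dual (hpart : d.IsVoronoiPartition) (hsupport : IsCompact d.support)
    (hcone_nonneg : ∀ ξ ∈ d.cone, 0 ≤ ξ (Fin.last S)) {k : Fin K}
    (hcell : ∃ ξ ∈ d.support, ∀ i, i ≠ k → euclDist ξ (d.gen k) < euclDist ξ (d.gen i))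
    (hties : ∀ n i k, d.sample n ∈ d.cell i → d.sample n ∈ d.cell k → i = k)
    (hidx : (d.idx k).Nonempty) (hε : 0 ≤ d.ε k)
    {Q : Matrix (Fin (S + 1)) (Fin (S + 1)) ℝ} (hQ : Q.IsSymm) {e : ℝ} (he : 0 < e) :
    ∃ P ∈ d.condAmbiguity k, P ∈ probOn (d.pureCell k) ∧
      ∃ (B : Matrix (Fin (S + 1)) (Fin (S + 1)) ℝ) (α : ℝ), B.IsSymm ∧
        B + α • vecMulVec (eLast S) (eLast S) ∈ copositive (d.cellCone k) ∧
        α + trace (Q * d.omegaHat k) + trace (B * d.omegaHat k) + d.ε k * frob (Qᵀ + B) ≤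
          ∫ ξ, quad Q ξ ∂P + e := by
  have hpc : d.pureCell k ⊆ d.support := (d.pureCell_subset k).trans
    (d.cell_subset_support hpart k)
  set C : Set (EuclideanSpace ℝ (Fin (S + 1) × Fin (S + 1))) :=
    (fun P => toEuclidean (secondMoment P)) '' probOn (d.pureCell k) with hCdef
  have hC : Convex ℝ C := by
    rintro _ ⟨P, hP, rfl⟩ _ ⟨P', hP', rfl⟩ a b ha hb hab
    refine ⟨_, mixture_mem_probOn hP hP' ha hb hab, ?_⟩
    simp only [secondMoment_mixture hsupport (probOn_mono hpc hP) (probOn_mono hpc hP') ha hb]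
    rfl
  have hCb : Bornology.IsBounded C := by
    obtain ⟨R, hR⟩ := hsupport.isBounded.exists_norm_le
    rw [isBounded_iff_forall_norm_le]
    refine ⟨√(∑ _i : Fin (S + 1), ∑ _j : Fin (S + 1), (R ^ 2) ^ 2), ?_⟩
    rintro _ ⟨P, hP, rfl⟩
    rw [norm_eq_frob, ofEuclidean_toEuclidean]
    exact frob_secondMoment_le hR (probOn_mono hpc hP)
  have hΩ : toEuclidean (d.omegaHat k) ∈ C :=
    ⟨d.empirical k, d.empirical_mem_probOn hpart hties hidx, by
      simp only [secondMoment_empirical]⟩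
  obtain ⟨_, ⟨P, hP, rfl⟩, hPε, V, u, hVu, hval⟩ :=
    exists_dual_of_inter_ball hC hCb hΩ (toEuclidean Q) hε he
  set V' := ofEuclidean V with hV'
  set W := (1 / 2 : ℝ) • (V' + V'ᵀ) with hW
  have hWs : W.IsSymm := by
    rw [hW, Matrix.IsSymm, transpose_smul, transpose_add, transpose_transpose, add_comm V'ᵀ]
  have hBs : (-(W + Q)).IsSymm := (hWs.add hQ).neg
  -- With `B = -(W + Q)` the matrix `Q + B` is `-W`, so the norm penalty is that of the separating
  -- functional, and `α` is the bound `u`.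
  refine ⟨P, ⟨probOn_mono (d.pureCell_subset k) hP, ?_⟩, hP, -(W + Q), u, hBs,
    ⟨hBs.add (isSymm_eLast.smul u), ?_⟩, ?_⟩
  · rw [secondMoment_empirical]
    rw [norm_eq_frob] at hPε
    exact hPε
  · refine d.quad_nonneg_of_pureCell hpart hsupport hcone_nonneg hcell fun ξ hξ => ?_
    -- The Dirac measure at `ξ` has second moment `ξξᵀ`, which turns the bound on `C` into a
    -- pointwise one.
    have h1 := hVu _ ⟨_, dirac_mem_probOn (d.measurableSet_pureCell hpart k) hξ, rfl⟩
    simp only [inner_toEuclidean, secondMoment_dirac, ofEuclidean_toEuclidean,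
      frobInner_vecMulVec] at h1
    have h2 : quad (-(W + Q)) ξ = -(quad V' ξ + quad Q ξ) := by
      rw [← quad_symmPart V', ← quad_add, ← neg_one_smul ℝ, quad_smul, hW]; ring
    rw [quad_add, h2, quad_smul, quad_eLast, (hpc hξ).2]
    linarith
  · rw [trace_mul_eq_frobInner _ _ (d.isSymm_omegaHat k),
      trace_mul_eq_frobInner _ _ (d.isSymm_omegaHat k), frobInner_neg, frobInner_add, hW,
      frobInner_symmPart _ _ (d.isSymm_omegaHat k), integral_quad hsupport (probOn_mono hpc hP),
      ← hW, hQ.eq]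
    have h1 : frob (Q + -(W + Q)) ≤ frob V' := by
      have : Q + -(W + Q) = -W := by abel
      rw [this, frob_neg]
      exact frob_symmPart_le V'
    simp only [inner_toEuclidean, ofEuclidean_toEuclidean, norm_eq_frob] at hval
    have h2 : d.ε k * frob (Q + -(W + Q)) ≤ d.ε k * frob V' := mul_le_mul_of_nonneg_left h1 hε
    linarith

/-- Weak duality for the conditional worst-case expectation in one cell. -/
lemma integral_quad_le (hpart : d.IsVoronoiPartition) (hsupport : IsCompact d.support) {k : Fin K}
    {Q B : Matrix (Fin (S + 1)) (Fin (S + 1)) ℝ} {α : ℝ}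
    (hB : B + α • vecMulVec (eLast S) (eLast S) ∈ copositive (d.cellCone k))
    {P : Measure (Vec (S + 1))} (hP : P ∈ d.condAmbiguity k) :
    ∫ ξ, quad Q ξ ∂P ≤
      α + trace (Q * d.omegaHat k) + trace (B * d.omegaHat k) + d.ε k * frob (Qᵀ + B) := by
  have := hP.1.1
  have hP' := probOn_mono (d.cell_subset_support hpart k) hP.1
  have h1 : 0 ≤ ∫ ξ, (quad B ξ + α) ∂P := by
    refine integral_nonneg_of_ae ?_
    filter_upwards [ae_mem_of_probOn hP.1] with ξ hξ
    have h := hB.2 ξ (d.voronoi_subset_cellCone k (hpart.nearest k hξ))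
    rw [quad_add, quad_smul, quad_eLast, (d.cell_subset_support hpart k hξ).2] at h
    simpa using h
  rw [integral_add (integrable_of_probOn hsupport hP' (continuous_quad B)) (integrable_const α),
    integral_quad hsupport hP'] at h1
  simp only [integral_const, probReal_univ, one_smul] at h1
  rw [trace_mul_eq_frobInner _ _ (d.isSymm_omegaHat k),
    trace_mul_eq_frobInner _ _ (d.isSymm_omegaHat k), integral_quad hsupport hP']
  -- Cauchy–Schwarz on the deviation of the moments; the remaining term `-⟨B, E[ξξᵀ]⟩` is at most
  -- `α` by `h1`.
  have h2 : frobInner (Qᵀ + B) (secondMoment P - d.omegaHat k) ≤ d.ε k * frob (Qᵀ + B) := by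
    refine (frobInner_le _ _).trans ?_
    rw [mul_comm, ← secondMoment_empirical]
    exact mul_le_mul_of_nonneg_right hP.2 (frob_nonneg _)
  rw [frobInner_sub_right, frobInner_add, frobInner_add,
    frobInner_transpose _ _ (isSymm_secondMoment P),
    frobInner_transpose _ _ (d.isSymm_omegaHat k)] at h2
  linarith

end Data

/-! ### Equivalence of the two problems -/

namespace Data
variable {N₁ N₂ S L K N : ℕ} (d : Data N₁ N₂ S L K N)

lemma feasible_of_copFeasible (hpart : d.IsVoronoiPartition) {w : CopPoint N₁ N₂ S L K}
    (hw : d.CopFeasible w) : d.Feasible w.toPoint := by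
  refine ⟨hw.1, fun l k ξ hξ => ?_⟩
  have h1 : 0 ≤ w (.π k l) + rowKap l * w .θ := hw.2 (.shift k l)
  have h2 := (hw.2 (.copositiveRow k l)).2 ξ (d.voronoi_subset_cellCone k (hpart.nearest k hξ))
  rw [quad_sub, quad_smul, quad_eLast, quad_delta, (d.cell_subset_support hpart k hξ).2] at h2
  have h3 : w.toPoint.θ = w .θ := rfl
  rw [h3]
  linarith

lemma pos_of_mem_chiBall {p : Fin K → ℝ} (hp : p ∈ d.chiBall) (hidx : ∀ k, (d.idx k).Nonempty)
    (k : Fin K) : 0 < p k :=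
  lt_of_le_of_ne (hp.1 k) fun h => (d.pHat_pos (hidx k)).ne' (hp.2.1 k h.symm)

/-- The part of the copositive objective that bounds the worst-case expectation. -/
def dualCost (w : CopPoint N₁ N₂ S L K) : ℝ :=
  d.γ * w .ω - w .η - 2 * ∑ k, d.pHat k * w (.r k) + 2 * w .ω * ∑ k, d.pHat k

/-- Weak duality for the worst-case expectation over the two-layer ambiguity set. -/
lemma expectedCost_le_dualCost (hpart : d.IsVoronoiPartition) (hsupport : IsCompact d.support)
    (hidx : ∀ k, (d.idx k).Nonempty) (hsum : ∑ k, d.pHat k = 1) {w : CopPoint N₁ N₂ S L K}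
    (hw : d.CopFeasible w) {P : Measure (Vec (S + 1))} (hP : P ∈ d.ambiguity) :
    d.expectedCost w.toPoint.Q P ≤ d.dualCost w := by
  obtain ⟨-, ⟨p, hp, Pc, hPc, rfl⟩, hnull⟩ := hP
  have hp0 := d.pos_of_mem_chiBall hp hidx
  rw [d.expectedCost_mixture _ hp0 (fun k => (hPc k).1) hnull]
  have hω : 0 ≤ w .ω := hw.2 .omegaNonneg
  have hlin : ∀ k, w (.s k) + w .η ≤ w .ω := fun k => hw.2 (.linear k)
  have hsoc : ∀ k, w (.r k) ^ 2 ≤ w .ω * (w .ω - w (.s k) - w .η) := fun k => by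
    have h : √(4 * w (.r k) ^ 2 + (w (.s k) + w .η) ^ 2) ≤ 2 * w .ω - w (.s k) - w .η :=
      hw.2 (.secondOrder k)
    rw [sub_sub] at h ⊢
    exact (sqrt_soc_le_iff hω (hlin k)).1 h
  have hs : ∀ k, ∫ ξ, quad (w.toPoint.Q k) ξ ∂(Pc k) ≤ w (.s k) := fun k =>
    (d.integral_quad_le hpart hsupport (hw.2 (.copositiveB k)) (hPc k)).trans
      (hw.2 (.frobenius k))
  calc ∑ k, p k * ∫ ξ, quad (w.toPoint.Q k) ξ ∂(Pc k) ≤ ∑ k, p k * w (.s k) :=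
        Finset.sum_le_sum fun k _ => mul_le_mul_of_nonneg_left (hs k) (hp0 k).le
    _ ≤ d.dualCost w := chi_weak_duality hp0 (fun k => (d.pHat_pos (hidx k)).le) hp.2.2.1 hsum
        hp.2.2.2 hω hlin hsoc

lemma copObjective_eq (w : CopPoint N₁ N₂ S L K) :
    d.copObjective w = d.c ⬝ᵥ w.toPoint.x + w.toPoint.θ + 1 / d.δ * d.dualCost w := rfl

lemma objective_le_copObjective (hδ : 0 < d.δ) (hpart : d.IsVoronoiPartition)
    (hsupport : IsCompact d.support) (hidx : ∀ k, (d.idx k).Nonempty)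
    (hsum : ∑ k, d.pHat k = 1) {w : CopPoint N₁ N₂ S L K} (hw : d.CopFeasible w) :
    d.objective w.toPoint ≤ ((d.copObjective w : ℝ) : EReal) := by
  rw [objective, copObjective_eq, EReal.coe_add (d.c ⬝ᵥ w.toPoint.x + w.toPoint.θ), EReal.coe_mul]
  refine add_le_add le_rfl (mul_le_mul_of_nonneg_left ?_ (EReal.coe_nonneg.2 (by positivity)))
  exact iSup₂_le fun P hP => EReal.coe_le_coe_iff.2
    (d.expectedCost_le_dualCost hpart hsupport hidx hsum hw hP)

lemma expectedCost_symm (z : Point N₁ N₂ S K) : d.expectedCost z.symm.Q = d.expectedCost z.Q := by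
  funext P
  simp only [expectedCost, Point.symm, quad_symmPart]

lemma objective_symm (z : Point N₁ N₂ S K) : d.objective z.symm = d.objective z := by
  rw [objective, expectedCost_symm, objective]
  rfl

/-- The point of the copositive program with components `z` and the given dual variables. -/
def mkCop (z : Point N₁ N₂ S K) (η ω : ℝ) (r s α : Fin K → ℝ) (π : Fin K → Row L → ℝ)
    (B : Fin K → Matrix (Fin (S + 1)) (Fin (S + 1)) ℝ) : CopPoint N₁ N₂ S L K
  | .x i => z.x i
  | .θ => z.θ
  | .η => η
  | .ω => ω
  | .r k => r k
  | .s k => s k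
  | .α k => α k
  | .π k l => π k l
  | .Y k i j => z.Y k i j
  | .Q k i j => z.Q k i j
  | .B k i j => B k i j

/-- Strong duality: the worst-case expectation is approximated by points of the copositive
program. -/
lemma exists_copFeasible (hpart : d.IsVoronoiPartition) (hsupport : IsCompact d.support)
    (hcone_nonneg : ∀ ξ ∈ d.cone, 0 ≤ ξ (Fin.last S))
    (hcell : ∀ k, ∃ ξ ∈ d.support, ∀ i, i ≠ k →
      euclDist ξ (d.gen k) < euclDist ξ (d.gen i))
    (hties : ∀ n i k, d.sample n ∈ d.cell i → d.sample n ∈ d.cell k → i = k)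
    (hidx : ∀ k, (d.idx k).Nonempty) (hγ : 0 ≤ d.γ) (hε : ∀ k, 0 ≤ d.ε k)
    (hsum : ∑ k, d.pHat k = 1) {z : Point N₁ N₂ S K} (hz : d.Feasible z) {e : ℝ} (he : 0 < e) :
    ∃ w : CopPoint N₁ N₂ S L K, d.CopFeasible w ∧ w.toPoint = z.symm ∧
      ∃ P ∈ d.ambiguity, d.dualCost w ≤ d.expectedCost z.Q P + e := by
  have hQ : ∀ k, (z.symm.Q k).IsSymm := fun k => by
    simp only [Point.symm, Matrix.IsSymm, transpose_smul, transpose_add, transpose_transpose]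
    rw [add_comm (z.Q k)ᵀ]
  choose Pc hPc hpure B α hBs hB hval using fun k =>
    d.exists_cond_dual hpart hsupport hcone_nonneg (hcell k) hties (hidx k) (hε k) (hQ k)
      (half_pos he)
  -- Each layer loses `e / 2`; since the weights sum to 1, the inner errors also add up to `e / 2`.
  obtain ⟨p, r, ω, η, hp, hps, hchi, hω, hs, hr, hdual⟩ :=
    chi_strong_duality (fun k => ∫ ξ, quad (z.symm.Q k) ξ ∂(Pc k) + e / 2)
      (fun k => d.pHat_pos (hidx k)) hsum hγ (half_pos he)
  have hpΔ : p ∈ d.chiBall :=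
    ⟨fun k => (hp k).le, fun k h => absurd h (hp k).ne', hps, hchi⟩
  have hmem := d.mixture_mem_ambiguity hpart hpΔ hPc hpure
  -- The copositive row constraints favour small `π`, so `π` is the least value that the shift
  -- constraints permit.
  refine ⟨mkCop z.symm η ω r (fun k => ∫ ξ, quad (z.symm.Q k) ξ ∂(Pc k) + e / 2) α
    (fun _ l => -(rowKap l * z.θ)) B, ⟨hz.1, ?_⟩, rfl, _, hmem, ?_⟩
  · rintro (_ | k | k | k | ⟨k, l⟩ | ⟨k, l⟩ | k | k)
    · exact hω
    · exact hs k
    · have := (sqrt_soc_le_iff hω (hs k)).2 (by simpa only [sub_sub] using hr k)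
      rw [← sub_sub] at this
      exact this
    · exact hval k
    · exact (neg_add_cancel (rowKap l * z.θ)).ge
    · refine ⟨(d.isSymm_delta l _ _ _).sub (isSymm_eLast.smul _), ?_⟩
      refine d.quad_nonneg_of_pureCell hpart hsupport hcone_nonneg (hcell k) fun ξ hξ => ?_
      have h := hz.2 l k ξ hξ.1
      change 0 ≤ quad (d.delta l z.x (z.Y k) (z.symm.Q k) -
        (-(rowKap l * z.θ)) • vecMulVec (eLast S) (eLast S)) ξ
      rw [quad_sub, quad_delta, quad_smul, quad_eLast, (d.cell_subset_support hpart k hξ.1).2]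
      have h2 : quad (z.symm.Q k) ξ = quad (z.Q k) ξ := quad_symmPart _ _
      rw [h2]
      linarith
    · exact hB k
    · exact hBs k
  · rw [← expectedCost_symm, d.expectedCost_mixture _ hp (fun k => (hPc k).1) hmem.2.2]
    refine hdual.trans ?_
    simp only [mul_add, Finset.sum_add_distrib, ← Finset.sum_mul, hps]
    linarith

/-- One inequality is weak duality, the other the approximation by `exists_copFeasible`.
Symmetrizing `Q_k` leaves the objective unchanged but matters for the copositive program: the
symmetric `B_k` cannot cancel a skew part of `Q_kᵀ` in the norm penalty. -/
lemma objective_eq_iInf (hδ : 0 < d.δ) (hpart : d.IsVoronoiPartition)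
    (hsupport : IsCompact d.support)
    (hcone_nonneg : ∀ ξ ∈ d.cone, 0 ≤ ξ (Fin.last S))
    (hcell : ∀ k, ∃ ξ ∈ d.support, ∀ i, i ≠ k →
      euclDist ξ (d.gen k) < euclDist ξ (d.gen i))
    (hties : ∀ n i k, d.sample n ∈ d.cell i → d.sample n ∈ d.cell k → i = k)
    (hidx : ∀ k, (d.idx k).Nonempty) (hγ : 0 ≤ d.γ) (hε : ∀ k, 0 ≤ d.ε k)
    (hsum : ∑ k, d.pHat k = 1) {z : Point N₁ N₂ S K} (hz : d.Feasible z) :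
    d.objective z = ⨅ w : CopPoint N₁ N₂ S L K, ⨅ (_ : d.CopFeasible w),
      ⨅ (_ : w.toPoint = z.symm), ((d.copObjective w : ℝ) : EReal) := by
  refine le_antisymm ?_ ?_
  · refine le_iInf fun w => le_iInf fun hw => le_iInf fun hwz => ?_
    rw [← objective_symm, ← hwz]
    exact d.objective_le_copObjective hδ hpart hsupport hidx hsum hw
  · have key : ∀ e : ℝ, 0 < e → (⨅ w : CopPoint N₁ N₂ S L K, ⨅ (_ : d.CopFeasible w),
        ⨅ (_ : w.toPoint = z.symm), ((d.copObjective w : ℝ) : EReal)) ≤ d.objective z + e := by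
      intro e he
      -- The error `d.δ * e` becomes `e` after multiplication by `1 / d.δ`.
      obtain ⟨w, hw, hwz, P, hP, hle⟩ := d.exists_copFeasible hpart hsupport hcone_nonneg hcell
        hties hidx hγ hε hsum hz (mul_pos hδ he)
      refine (iInf₂_le_of_le w hw (iInf_le _ hwz)).trans ?_
      have h1 : d.copObjective w ≤
          d.c ⬝ᵥ z.x + z.θ + 1 / d.δ * d.expectedCost z.Q P + e := by
        rw [copObjective_eq, hwz]
        have h2 : 1 / d.δ * d.dualCost w ≤ 1 / d.δ * (d.expectedCost z.Q P + d.δ * e) := by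
          gcongr
        have h3 : 1 / d.δ * (d.expectedCost z.Q P + d.δ * e) =
            1 / d.δ * d.expectedCost z.Q P + e := by field_simp
        have h4 : z.symm.x = z.x := rfl
        have h5 : z.symm.θ = z.θ := rfl
        rw [h4, h5]
        linarith
      refine (EReal.coe_le_coe_iff.2 h1).trans ?_
      rw [EReal.coe_add, EReal.coe_add (d.c ⬝ᵥ z.x + z.θ), EReal.coe_mul, objective]
      refine add_le_add (add_le_add le_rfl
        (mul_le_mul_of_nonneg_left ?_ (EReal.coe_nonneg.2 (by positivity)))) le_rfl
      exact le_iSup₂_of_le P hP le_rfl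
    refine EReal.le_of_forall_lt_iff_le.1 fun b hb => ?_
    rcases eq_or_ne (d.objective z) ⊥ with hbot | hbot
    · have := key 1 one_pos
      rw [hbot, EReal.bot_add] at this
      exact this.trans bot_le
    · have htop : d.objective z ≠ ⊤ := hb.ne_top
      lift d.objective z to ℝ using ⟨htop, hbot⟩ with a ha
      rw [EReal.coe_lt_coe_iff] at hb
      have := key (b - a) (sub_pos.2 hb)
      rwa [← EReal.coe_add, add_sub_cancel] at this

lemma optimalValue_eq_copValue (hδ : 0 < d.δ) (hpart : d.IsVoronoiPartition)
    (hsupport : IsCompact d.support)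
    (hcone_nonneg : ∀ ξ ∈ d.cone, 0 ≤ ξ (Fin.last S))
    (hcell : ∀ k, ∃ ξ ∈ d.support, ∀ i, i ≠ k →
      euclDist ξ (d.gen k) < euclDist ξ (d.gen i))
    (hties : ∀ n i k, d.sample n ∈ d.cell i → d.sample n ∈ d.cell k → i = k)
    (hidx : ∀ k, (d.idx k).Nonempty) (hγ : 0 ≤ d.γ) (hε : ∀ k, 0 ≤ d.ε k)
    (hsum : ∑ k, d.pHat k = 1) : d.optimalValue = d.copValue := by
  refine le_antisymm ?_ ?_
  · refine le_iInf₂ fun w hw => iInf₂_le_of_le w.toPoint (d.feasible_of_copFeasible hpart hw) ?_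
    exact d.objective_le_copObjective hδ hpart hsupport hidx hsum hw
  · refine le_iInf₂ fun z hz => ?_
    rw [d.objective_eq_iInf hδ hpart hsupport hcone_nonneg hcell hties hidx hγ hε hsum hz]
    exact iInf_mono fun w => iInf_mono fun hw => le_iInf fun _ => le_rfl

end Data

/-! ### Size of the copositive program -/

/-- The scalar variables, grouped by cell. -/
def copVarEquiv (N₁ N₂ S L K : ℕ) : CopVar N₁ N₂ S L K ≃
    Fin N₁ ⊕ Fin 3 ⊕ Fin K × (Fin 3 ⊕ Row L ⊕ Fin N₂ × Fin (S + 1) ⊕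
      Fin 2 × Fin (S + 1) × Fin (S + 1)) where
  toFun
    | .x i => .inl i
    | .θ => .inr (.inl 0)
    | .η => .inr (.inl 1)
    | .ω => .inr (.inl 2)
    | .r k => .inr (.inr (k, .inl 0))
    | .s k => .inr (.inr (k, .inl 1))
    | .α k => .inr (.inr (k, .inl 2))
    | .π k l => .inr (.inr (k, .inr (.inl l)))
    | .Y k i j => .inr (.inr (k, .inr (.inr (.inl (i, j)))))
    | .Q k i j => .inr (.inr (k, .inr (.inr (.inr (0, i, j)))))
    | .B k i j => .inr (.inr (k, .inr (.inr (.inr (1, i, j)))))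
  invFun
    | .inl i => .x i
    | .inr (.inl 0) => .θ
    | .inr (.inl 1) => .η
    | .inr (.inl 2) => .ω
    | .inr (.inr (k, .inl 0)) => .r k
    | .inr (.inr (k, .inl 1)) => .s k
    | .inr (.inr (k, .inl 2)) => .α k
    | .inr (.inr (k, .inr (.inl l))) => .π k l
    | .inr (.inr (k, .inr (.inr (.inl (i, j))))) => .Y k i j
    | .inr (.inr (k, .inr (.inr (.inr (0, i, j))))) => .Q k i j
    | .inr (.inr (k, .inr (.inr (.inr (1, i, j))))) => .B k i j
  left_inv v := by cases v <;> rfl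
  right_inv v := by
    rcases v with i | i | ⟨k, i | l | ⟨i, j⟩ | ⟨b, i, j⟩⟩
    · rfl
    · fin_cases i <;> rfl
    · fin_cases i <;> rfl
    · rfl
    · rfl
    · fin_cases b <;> rfl

/-- The constraints, grouped by cell. -/
def copConstrEquiv (L K : ℕ) : CopConstr L K ≃ Unit ⊕ Fin K × (Fin 2 × Row L ⊕ Fin 5) where
  toFun
    | .omegaNonneg => .inl ()
    | .linear k => .inr (k, .inr 0)
    | .secondOrder k => .inr (k, .inr 1)
    | .frobenius k => .inr (k, .inr 2)
    | .shift k l => .inr (k, .inl (0, l))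
    | .copositiveRow k l => .inr (k, .inl (1, l))
    | .copositiveB k => .inr (k, .inr 3)
    | .symmetricB k => .inr (k, .inr 4)
  invFun
    | .inl () => .omegaNonneg
    | .inr (k, .inr 0) => .linear k
    | .inr (k, .inr 1) => .secondOrder k
    | .inr (k, .inr 2) => .frobenius k
    | .inr (k, .inl (0, l)) => .shift k l
    | .inr (k, .inl (1, l)) => .copositiveRow k l
    | .inr (k, .inr 3) => .copositiveB k
    | .inr (k, .inr 4) => .symmetricB k
  left_inv v := by cases v <;> rfl
  right_inv v := by
    rcases v with ⟨⟩ | ⟨k, ⟨b, l⟩ | i⟩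
    · rfl
    · fin_cases b <;> rfl
    · fin_cases i <;> rfl

lemma card_copVar (N₁ N₂ S L K : ℕ) : Nat.card (CopVar N₁ N₂ S L K) =
    N₁ + 3 + K * (3 + (L + 2) + N₂ * (S + 1) + 2 * (S + 1) ^ 2) := by
  rw [Nat.card_congr (copVarEquiv N₁ N₂ S L K)]
  simp
  ring

lemma card_copConstr (L K : ℕ) : Nat.card (CopConstr L K) = 1 + K * (2 * (L + 2) + 5) := by
  rw [Nat.card_congr (copConstrEquiv L K)]
  simp

end PDR

end

theorem theorem1 {N₁ N₂ S L K N : ℕ} (d : PDR.Data N₁ N₂ S L K N)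
    (hδ : 0 < d.δ) (hδ1 : d.δ ≤ 1)
    (hcone_nonneg : ∀ ξ ∈ d.cone, 0 ≤ ξ (Fin.last S))
    (hcone_closed : IsClosed (d.cone : Set (PDR.Vec (S + 1))))
    (hcone_full : (interior (d.cone : Set (PDR.Vec (S + 1)))).Nonempty)
    (hsupport : IsCompact d.support)
    (hpart : d.IsVoronoiPartition)
    (hcell : ∀ k, ∃ ξ ∈ d.support, ∀ i, i ≠ k →
      PDR.euclDist ξ (d.gen k) < PDR.euclDist ξ (d.gen i))
    (hsample : ∀ i, d.sample i ∈ d.support)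
    (hties : ∀ n i k, d.sample n ∈ d.cell i → d.sample n ∈ d.cell k → i = k)
    (hidx : ∀ k, (d.idx k).Nonempty)
    (hγ : 0 ≤ d.γ) (hε : ∀ k, 0 ≤ d.ε k) :
    -- the two problems have the same optimal value
    d.optimalValue = d.copValue ∧
    -- each feasible point of the copositive program yields decision rules that are no costlier
    (∀ w : PDR.CopPoint N₁ N₂ S L K, d.CopFeasible w →
      d.Feasible w.toPoint ∧ d.objective w.toPoint ≤ ((d.copObjective w : ℝ) : EReal)) ∧
    -- the cost of feasible decision rules is the optimal value of the copositive program in the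
    -- remaining variables, once each `Q_k` is replaced by its symmetric part
    (∀ z : PDR.Point N₁ N₂ S K, d.Feasible z →
      d.objective z = ⨅ w : PDR.CopPoint N₁ N₂ S L K, ⨅ (_ : d.CopFeasible w),
        ⨅ (_ : w.toPoint = z.symm), ((d.copObjective w : ℝ) : EReal)) ∧
    -- the copositive program has polynomial size: number of scalar variables and of constraints
    Nat.card (PDR.CopVar N₁ N₂ S L K) =
      N₁ + 3 + K * (3 + (L + 2) + N₂ * (S + 1) + 2 * (S + 1) ^ 2) ∧
    Nat.card (PDR.CopConstr L K) = 1 + K * (2 * (L + 2) + 5) := by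
  have hsum := d.sum_pHat hpart (d.support_nonempty hcone_nonneg hcone_full) hsample hties hidx
  exact ⟨d.optimalValue_eq_copValue hδ hpart hsupport hcone_nonneg hcell hties hidx hγ hε hsum,
    fun w hw => ⟨d.feasible_of_copFeasible hpart hw,
      d.objective_le_copObjective hδ hpart hsupport hidx hsum hw⟩,
    fun z hz => d.objective_eq_iInf hδ hpart hsupport hcone_nonneg hcell hties hidx hγ hε hsum hz,
    PDR.card_copVar N₁ N₂ S L K, PDR.card_copConstr L K⟩
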